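/- **Theorem.** Let $\lambda_{\mathrm r},\lambda_{\mathrm P},m,a>0$. Let the road side units (RSUs) form a homogeneous Poisson point process $\Phi=\{z_i\}$ on $\mathbb R$ of density $\lambda_{\mathrm r}$, and let the vehicles form an independent one-dimensional Matérn cluster process $\Phi_{\mathrm m}$: the parents form a homogeneous Poisson point process of density $\lambda_{\mathrm P}$ on $\mathbb R$; independently, each parent $x$ has a Poisson number, with mean $m$, of daughter points that are independent and uniform on $[x-a,x+a]$; and $\Phi_{\mathrm m}$ is the union of all the sets of daughter points. The Voronoi cell of $z\in\Phi$ is $V_z=\{y\in\mathbb R: |y-z|\le|y-z'| \text{ for all } z'\in\Phi\}$. Let $L$ be the length of the cell of the typical RSU and $S_{\mathrm P}$ the number of vehicles in this cell; that is, for every Borel set $B\subset\mathbb R$ of finite positive length $|B|$, $$\mathbb P[S_{\mathrm P}=k]=\frac{1}{\lambda_{\mathrm r}|B|}\,\mathbb E\,\#\{z\in\Phi\cap B:\ \#(\Phi_{\mathrm m}\cap V_z)=k\},\qquad \mathbb P[L\in A]=\frac{1}{\lambda_{\mathrm r}|B|}\,\mathbb E\,\#\{z\in\Phi\cap B:\ |V_z|\in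 A\}$$ (the Palm distribution of $\Phi$, under which the typical RSU is at the origin). For $r>0$ put $$g(s,r)=2\lambda_{\mathrm P}\left(\int_0^{r+a}e^{\,m\,\frac{\mathcal A(r,a,x)}{2a}(s-1)}\,\mathrm dx-(r+a)\right),$$ where $\mathcal A(r,a,x)$ is the length of the intersection of two intervals of half-lengths $r$ and $a$ with centers at distance $x$: $\mathcal A(r,a,x)=2\min(r,a)$ if $x\le|r-a|$ and $\mathcal A(r,a,x)=r+a-x$ if $|r-a|<x<r+a$. Then: 1. For every $c\in\mathbb R$, $r>0$ and $s\in[-1,1]$, the probability generating function (PGF) of the number of points of $\Phi_{\mathrm m}$ in $[c-r,c+r]$ at $s$ is $e^{g(s,r)}$. 2. $L$ has the density $f_L(t)=4\lambda_{\mathrm r}^2\,t\,e^{-2\lambda_{\mathrm r}t}$ on $(0,\infty)$. 3. For every $s\in[-1,1]$, the PGF of $S_{\mathrm P}$ is $$\mathcal P_{S_{\mathrm P}}(s)=\sum_{k\ge0}\mathbb P[S_{\mathrm P}=k]\,s^k=\int_0^\infty e^{g(s,t/2)}f_L(t)\,\mathrm dt .$$ 4. For every integer $k\ge0$, $$\mathbb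 P[S_{\mathrm P}=k]=\int_0^\infty\ \sum_{(b_1,\dots,b_k)}\frac{e^{g(0,t/2)}}{b_1!\cdots b_k!}\prod_{i=1}^k\left(\frac{g^{(i)}(0,t/2)}{i!}\right)^{b_i}f_L(t)\,\mathrm dt ,$$ where the sum is over all $k$-tuples of integers $b_i\ge0$ with $b_1+2b_2+\dots+kb_k=k$, and $g^{(i)}(0,r)$ is the $i$-th derivative of $s\mapsto g(s,r)$ at $s=0$. The integrals in 3 and 4 converge absolutely. -/

import Mathlib

open MeasureTheory ProbabilityTheory Set
open scoped ENNReal NNReal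

namespace Platoon

noncomputable section

/-- The number of points of the enumerated point process `{z₀, z₁, …}` lying in `B`. -/
def count {Ω : Type*} (z : ℕ → Ω → ℝ) (B : Set ℝ) (ω : Ω) : ℕ∞ :=
  {i : ℕ | z i ω ∈ B}.encard

/-- `z₀, z₁, …` are the points of a homogeneous Poisson point process on `ℝ` with density `lam`:
the number of points in a Borel set of finite length `|B|` is Poisson with mean `lam * |B|`, and
the numbers of points in pairwise disjoint Borel sets are independent. -/
structure IsPoissonProcess {Ω : Type*} [MeasurableSpace Ω] (P : Measure Ω)
    (z : ℕ → Ω → ℝ) (lam : ℝ) : Prop where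
  measurable : ∀ i, Measurable (z i)
  count_law : ∀ B : Set ℝ, MeasurableSet B → volume B ≠ ∞ → ∀ n : ℕ,
    P {ω | count z B ω = n} = poissonMeasure (lam.toNNReal * (volume B).toNNReal) {n}
  count_indep : ∀ (n : ℕ) (B : Fin n → Set ℝ), (∀ j, MeasurableSet (B j)) →
    Pairwise (fun j j' => Disjoint (B j) (B j')) → iIndepFun (fun j => count z (B j)) P

/-- The ingredients of a one-dimensional Matérn cluster process: parent points `x i` forming a
Poisson process of density `lamP`; the `i`-th parent has `K i` daughters, `K i` being Poisson with
mean `m`; the displacement `U i j` of the `j`-th daughter from the `i`-th parent is uniform on the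
ball `[-a, a]`; and the parent process, all the numbers `K i` and all the displacements `U i j`
are independent. -/
structure IsMaternCluster {Ω : Type*} [MeasurableSpace Ω] (P : Measure Ω)
    (x : ℕ → Ω → ℝ) (K : ℕ → Ω → ℕ) (U : ℕ → ℕ → Ω → ℝ) (lamP m a : ℝ) : Prop where
  parents : IsPoissonProcess P x lamP
  measurable_K : ∀ i, Measurable (K i)
  law_K : ∀ i, P.map (K i) = poissonMeasure m.toNNReal
  measurable_U : ∀ i j, Measurable (U i j)
  law_U : ∀ i j, pdf.IsUniform (U i j) (Icc (-a) a) P volume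
  indep_K : iIndepFun K P
  indep_U : iIndepFun (fun p : ℕ × ℕ => U p.1 p.2) P
  indep_K_U : IndepFun (fun ω i => K i ω) (fun ω i j => U i j ω) P
  indep_parents : IndepFun (fun ω i => x i ω)
    (fun ω => ((fun i => K i ω), (fun i j => U i j ω))) P

/-- The cluster process: the union over the parents of the daughter point sets. -/
def clusterProcess {Ω : Type*} (x : ℕ → Ω → ℝ) (K : ℕ → Ω → ℕ) (U : ℕ → ℕ → Ω → ℝ)
    (ω : Ω) : Set ℝ :=
  ⋃ i : ℕ, {y : ℝ | ∃ j < K i ω, y = x i ω + U i j ω}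

/-- The Voronoi cell of the point `z i` in the configuration `{z₀, z₁, …}`. -/
def cell {Ω : Type*} (z : ℕ → Ω → ℝ) (i : ℕ) (ω : Ω) : Set ℝ :=
  {y : ℝ | ∀ j, |y - z i ω| ≤ |y - z j ω|}

/-- The load on the RSU `z i`: the number of points of the vehicle process `Φ` in its cell. -/
def load {Ω : Type*} (z : ℕ → Ω → ℝ) (Φ : Ω → Set ℝ) (i : ℕ) (ω : Ω) : ℕ∞ :=
  (Φ ω ∩ cell z i ω).encard

/-- The (Palm) probability that the typical point of the stationary point process `{z₀, z₁, …}` of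
density `lam` has a property, where `E i` is the event that `z i` has it: the expected number of
points in the window `B` with the property, divided by the expected number `lam * |B|` of points
in `B`. For a property that is invariant under translations (a cell length, a load) this is
the probability of the property for the point at the origin, given that there is one. -/
def typicalProb {Ω : Type*} [MeasurableSpace Ω] (P : Measure Ω) (z : ℕ → Ω → ℝ) (lam : ℝ)
    (B : Set ℝ) (E : ℕ → Set Ω) : ℝ≥0∞ :=
  (∑' i, P ({ω | z i ω ∈ B} ∩ E i)) / (ENNReal.ofReal lam * volume B)

/-- The length of the intersection of two intervals of half-lengths `r` and `a` whose centers are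
at distance `x ≥ 0`. -/
def overlap (r a x : ℝ) : ℝ :=
  if x ≤ |r - a| then 2 * min r a else if x < r + a then r + a - x else 0

/-- The exponent `g(s, r)` of the PGF of the number of points of the cluster process in a ball of
radius `r`. -/
def g (lamP m a s r : ℝ) : ℝ :=
  2 * lamP * ((∫ x in (0 : ℝ)..(r + a), Real.exp (m * (overlap r a x / (2 * a)) * (s - 1)))
    - (r + a))

/-- The density of the length of the typical cell. -/
def fL (lamR t : ℝ) : ℝ := 4 * lamR ^ 2 * t * Real.exp (-2 * lamR * t)

/-- The set of `k`-tuples `(b₁, …, b_k)` of natural numbers with `b₁ + 2 b₂ + … + k b_k = k`;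
the entry `b_{i+1}` is `b i`, for `i : Fin k`. -/
def tuples (k : ℕ) : Finset (Fin k → ℕ) :=
  (Fintype.piFinset fun _ => Finset.range (k + 1)).filter
    fun b => ∑ i : Fin k, ((i : ℕ) + 1) * b i = k

theorem mem_tuples (k : ℕ) (b : Fin k → ℕ) :
    b ∈ tuples k ↔ ∑ i : Fin k, ((i : ℕ) + 1) * b i = k := by
  simp only [tuples, Finset.mem_filter, Fintype.mem_piFinset, Finset.mem_range,
    and_iff_right_iff_imp]
  intro h i
  have h1 : ((i : ℕ) + 1) * b i ≤ ∑ i : Fin k, ((i : ℕ) + 1) * b i :=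
    Finset.single_le_sum (f := fun i : Fin k => ((i : ℕ) + 1) * b i)
      (fun _ _ => Nat.zero_le _) (Finset.mem_univ i)
  nlinarith [Nat.zero_le ((i : ℕ) * b i)]

/-- The integrand of the PMF formula at `k`, without the density of the cell length:
`∑ e^{g(0,r)} / (b₁! ⋯ b_k!) ∏ (g^{(i)}(0,r) / i!)^{b_i}`, the sum being over `tuples k` and
`g^{(i)}` denoting the `i`-th derivative in the first argument. -/
def faaDiBruno (lamP m a : ℝ) (k : ℕ) (r : ℝ) : ℝ :=
  ∑ b ∈ tuples k,
    Real.exp (g lamP m a 0 r) / (∏ i : Fin k, ((b i).factorial : ℝ)) *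
      ∏ i : Fin k, (iteratedDeriv ((i : ℕ) + 1) (fun s => g lamP m a s r) 0 /
        (((i : ℕ) + 1).factorial : ℝ)) ^ b i

end

end Platoon

/-! On the line, the Voronoi cell of a point is an interval reaching halfway to its two neighbours,
so everything about the typical cell is contained in the joint law of the right and left gaps. For a
Poisson process these gaps are independent exponentials under the Palm measure
(`tsum_measure_inter_gapEvent`, `sum_map_gaps`). This is proved without Palm calculus: the window is
cut into short pieces, and on each piece the event that a point has gaps at least u and v is
bracketed by events about counts in disjoint sets. The cell length is half the sum of the gaps,
which yields the Gamma density `fL`.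

For the vehicles, condition on the parents. A daughter of a parent at y hits the ball with
probability `hitProb`, so thinning the Poisson number of daughters gives each parent a factor exp(m
(s - 1) hitProb). The expectation of the product over all parents is the Laplace functional of the
parent process (`integral_exp_neg_tsum`), and its exponent is g(s, r) (`g_eq_integral`), independent
of the center. Displacements have no atoms, so almost surely no two daughters coincide and counting
points is the same as counting daughters.

Since the RSUs are independent of the vehicles, freezing the RSU configuration turns the cell into a
deterministic ball. The load then has the law of a ball count with the length of the cell, and
averaging over the Palm law of the gaps integrates this law against `fL` (`measure_inter_load`,
`typicalProb_load`). Summing over k under the integral gives the PGF. The PMF follows from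
extracting Taylor coefficients of exp(g(s, r)) in s, which is Faà di Bruno's formula for the
exponential, obtained here from formal power series. -/

namespace Platoon

noncomputable section

/-! ### The exponential formula for Taylor coefficients -/

/-- The formal power series `exp (c X ^ (i + 1))`. -/
def expMonomial (c : ℝ) (i : ℕ) : PowerSeries ℝ :=
  PowerSeries.mk fun n =>
    if (i + 1) ∣ n then c ^ (n / (i + 1)) / ((n / (i + 1)).factorial : ℝ) else 0

/-- The chain rule, checked on coefficients: when n + 1 = (i + 1)(b + 1), differentiation produces
the factor (i + 1)(b + 1), and b + 1 cancels against the factorial. -/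
theorem derivative_expMonomial (c : ℝ) (i : ℕ) :
    PowerSeries.derivative ℝ (expMonomial c i) =
      (PowerSeries.C ((i + 1 : ℝ) * c) * PowerSeries.X ^ i) * expMonomial c i := by
  ext n
  rw [PowerSeries.coeff_derivative, mul_assoc, PowerSeries.coeff_C_mul,
    PowerSeries.coeff_X_pow_mul', expMonomial, PowerSeries.coeff_mk, PowerSeries.coeff_mk]
  by_cases h : (i + 1) ∣ n + 1
  · obtain ⟨b, hb⟩ := h
    obtain ⟨b, rfl⟩ : ∃ b', b = b' + 1 := Nat.exists_eq_succ_of_ne_zero (by rintro rfl; simp at hb)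
    have hn : n = (i + 1) * b + i := by rw [Nat.mul_add] at hb; omega
    have h1 : (n + 1) / (i + 1) = b + 1 := by rw [hb]; exact Nat.mul_div_cancel_left _ (by omega)
    have h2 : (n - i) = (i + 1) * b := by omega
    have h3 : (n + 1 : ℝ) = (i + 1) * (b + 1) := by exact_mod_cast hb
    rw [if_pos ⟨_, hb⟩, if_pos (by omega), if_pos ⟨b, h2⟩, h1, h2,
      Nat.mul_div_cancel_left _ (by omega), h3, Nat.factorial_succ]
    push_cast
    field_simp
    ring
  · rw [if_neg h]
    split_ifs with h1 h2
    · exfalso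
      apply h
      obtain ⟨b, hb⟩ := h2
      exact ⟨b + 1, by rw [Nat.mul_add]; omega⟩
    · simp
    · simp

theorem derivative_prod_eq {ι : Type*} (s : Finset ι) (F A : ι → PowerSeries ℝ)
    (h : ∀ i, PowerSeries.derivative ℝ (F i) = A i * F i) :
    PowerSeries.derivative ℝ (∏ i ∈ s, F i) = (∑ i ∈ s, A i) * ∏ i ∈ s, F i := by
  classical
  induction s using Finset.induction_on with
  | empty => simp
  | insert a s ha ih =>
    rw [Finset.prod_insert ha, Finset.sum_insert ha, Derivation.leibniz, ih, h]
    simp only [smul_eq_mul]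
    ring

/-- The recursion satisfied by the Taylor coefficients of the exponential of a function determines
them. -/
theorem eq_mul_coeff_prod_expMonomial (k : ℕ) (c e : ℕ → ℝ)
    (h : ∀ n : ℕ, (n + 1 : ℝ) * e (n + 1) = ∑ i ∈ Finset.range (n + 1), (i + 1 : ℝ) * c i * e (n - i))
    (n : ℕ) (hn : n ≤ k) :
    e n = e 0 * PowerSeries.coeff n (∏ i : Fin k, expMonomial (c i) i) := by
  induction n using Nat.strong_induction_on with
  | _ n ih =>
  rcases n with _ | n
  · simp [← PowerSeries.coeff_zero_eq_constantCoeff_apply, expMonomial]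
  set Q := ∏ i : Fin k, expMonomial (c i) i with hQ
  -- Logarithmic derivatives add over a product, so the coefficients of Q satisfy the same recursion
  -- as `e`; only the initial value `e 0` differs.
  have hD : PowerSeries.derivative ℝ Q =
      (∑ i : Fin k, PowerSeries.C ((i + 1 : ℝ) * c i) * PowerSeries.X ^ (i : ℕ)) * Q :=
    derivative_prod_eq _ _ _ fun i => derivative_expMonomial _ _
  have h1 := congrArg (PowerSeries.coeff n) hD
  rw [PowerSeries.coeff_derivative, Finset.sum_mul, map_sum] at h1
  simp_rw [mul_assoc (PowerSeries.C _), PowerSeries.coeff_C_mul, PowerSeries.coeff_X_pow_mul'] at h1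
  rw [Fin.sum_univ_eq_sum_range (fun i : ℕ => ((i : ℝ) + 1) * c i *
    (if i ≤ n then PowerSeries.coeff (n - i) Q else 0))] at h1
  -- Cutting the product off at k factors is harmless: X ^ i with i > n does not reach the
  -- coefficient of order n, and n + 1 ≤ k.
  have h2 : ∑ i ∈ Finset.range k, ((i : ℝ) + 1) * c i *
      (if i ≤ n then PowerSeries.coeff (n - i) Q else 0) =
      ∑ i ∈ Finset.range (n + 1), ((i : ℝ) + 1) * c i * PowerSeries.coeff (n - i) Q := by
    symm
    rw [← Finset.sum_subset (Finset.range_subset_range.2 hn)]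
    · refine Finset.sum_congr rfl fun i hi => ?_
      rw [if_pos (by rw [Finset.mem_range] at hi; omega)]
    · intro i _ hi
      rw [if_neg (by rw [Finset.mem_range] at hi; omega), mul_zero]
  rw [h2] at h1
  have h3 : (n + 1 : ℝ) * e (n + 1) = (n + 1 : ℝ) * (e 0 * PowerSeries.coeff (n + 1) Q) := by
    rw [h n, mul_left_comm, mul_comm (n + 1 : ℝ) (PowerSeries.coeff _ _), h1, Finset.mul_sum]
    refine Finset.sum_congr rfl fun i hi => ?_
    rw [ih (n - i) (by omega) (by omega)]
    ring
  exact mul_left_cancel₀ (by positivity) h3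

/-- The coefficient is a sum over all ways l of splitting the exponent k among the factors. A term
survives only if i + 1 divides l i for every i, and then l i = (i + 1) b i for a unique tuple b. -/
theorem coeff_prod_expMonomial (k : ℕ) (c : ℕ → ℝ) :
    PowerSeries.coeff k (∏ i : Fin k, expMonomial (c i) i) =
      ∑ b ∈ tuples k, (∏ i : Fin k, ((b i).factorial : ℝ))⁻¹ * ∏ i : Fin k, c i ^ b i := by
  classical
  rw [PowerSeries.coeff_prod]
  symm
  refine Finset.sum_of_injOn
    (fun b => Finsupp.equivFunOnFinite.symm fun i : Fin k => ((i : ℕ) + 1) * b i) ?_ ?_ ?_ ?_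
  · intro b _ b' _ hbb
    ext i
    have := DFunLike.congr_fun hbb i
    simpa using this
  · intro b hb
    simp only [Finset.mem_coe, Finset.mem_finsuppAntidiag, Finset.subset_univ, and_true]
    simpa using (mem_tuples k b).1 hb
  · intro l hl hl'
    by_contra hne
    have hdiv : ∀ i : Fin k, ((i : ℕ) + 1) ∣ l i := by
      intro i
      by_contra hi
      exact hne (Finset.prod_eq_zero (Finset.mem_univ i) (by simp [expMonomial, hi]))
    apply hl'
    refine ⟨fun i => l i / ((i : ℕ) + 1), ?_, ?_⟩
    · rw [Finset.mem_coe, mem_tuples]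
      simp only [Finset.mem_finsuppAntidiag, Finset.subset_univ, and_true] at hl
      exact (Finset.sum_congr rfl fun i _ => Nat.mul_div_cancel' (hdiv i)).trans hl
    · ext i
      simpa using Nat.mul_div_cancel' (hdiv i)
  · intro b _
    rw [← Finset.prod_inv_distrib, ← Finset.prod_mul_distrib]
    refine Finset.prod_congr rfl fun i _ => ?_
    simp [expMonomial, div_eq_inv_mul, Nat.mul_div_cancel_left _ (Nat.succ_pos (i : ℕ))]

/-- Faà di Bruno's formula for the exponential of an analytic function. -/
theorem iteratedDeriv_exp_comp_div_factorial {f : ℝ → ℝ} (hf : AnalyticAt ℝ f 0) (k : ℕ) :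
    iteratedDeriv k (fun s => Real.exp (f s)) 0 / (k.factorial : ℝ) =
      ∑ b ∈ tuples k, Real.exp (f 0) / (∏ i : Fin k, ((b i).factorial : ℝ)) *
        ∏ i : Fin k, (iteratedDeriv ((i : ℕ) + 1) f 0 / (((i : ℕ) + 1).factorial : ℝ)) ^ b i := by
  have hrec : ∀ n : ℕ, (n + 1 : ℝ) *
      (iteratedDeriv (n + 1) (fun s => Real.exp (f s)) 0 / ((n + 1).factorial : ℝ)) =
      ∑ i ∈ Finset.range (n + 1),
        (i + 1 : ℝ) * (iteratedDeriv (i + 1) f 0 / ((i + 1).factorial : ℝ)) *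
        (iteratedDeriv (n - i) (fun s => Real.exp (f s)) 0 / ((n - i).factorial : ℝ)) := by
    intro n
    -- The recursion is Leibniz's rule applied to (exp f)' = f' exp f. This identity is available
    -- only near 0, which suffices for derivatives at 0.
    have h1 : deriv (fun s => Real.exp (f s)) =ᶠ[nhds 0]
        fun s => deriv f s * Real.exp (f s) := by
      filter_upwards [hf.eventually_analyticAt] with s hs
      rw [deriv_exp hs.differentiableAt, mul_comm]
    have h2 : ContDiffAt ℝ n (fun s => Real.exp (f s)) 0 := hf.rexp.contDiffAt
    rw [iteratedDeriv_succ', h1.iteratedDeriv_eq, iteratedDeriv_fun_mul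
      hf.deriv.contDiffAt h2, Finset.sum_div, Finset.mul_sum]
    refine Finset.sum_congr rfl fun i hi => ?_
    have hi' : i ≤ n := by rw [Finset.mem_range] at hi; omega
    rw [← iteratedDeriv_succ', Nat.cast_choose ℝ hi', Nat.factorial_succ, Nat.factorial_succ]
    push_cast
    field_simp
  rw [eq_mul_coeff_prod_expMonomial k
    (fun i => iteratedDeriv (i + 1) f 0 / ((i + 1).factorial : ℝ))
    (fun n => iteratedDeriv n (fun s => Real.exp (f s)) 0 / (n.factorial : ℝ)) hrec k le_rfl,
    coeff_prod_expMonomial k (fun i => iteratedDeriv (i + 1) f 0 / ((i + 1).factorial : ℝ)),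
    Finset.mul_sum]
  refine Finset.sum_congr rfl fun b _ => ?_
  simp [div_eq_mul_inv, mul_assoc]

/-- The coefficients of a convergent power series are the Taylor coefficients of its sum. -/
theorem hasFPowerSeriesAt_of_hasSum {p : ℕ → ℝ} {f : ℝ → ℝ}
    (h : ∀ s ∈ Icc (-1 : ℝ) 1, HasSum (fun n => p n * s ^ n) (f s)) :
    HasFPowerSeriesAt f (FormalMultilinearSeries.ofScalars ℝ p) 0 := by
  rw [hasFPowerSeriesAt_iff]
  filter_upwards [Icc_mem_nhds (show (-1 : ℝ) < 0 by norm_num) zero_lt_one] with s hs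
  simpa [mul_comm] using h s hs

theorem eq_iteratedDeriv_of_hasSum {p : ℕ → ℝ} {f : ℝ → ℝ}
    (h : ∀ s ∈ Icc (-1 : ℝ) 1, HasSum (fun n => p n * s ^ n) (f s)) (k : ℕ) :
    p k = iteratedDeriv k f 0 / (k.factorial : ℝ) := by
  have h1 := hasFPowerSeriesAt_of_hasSum h
  have h2 := h1.eq_formalMultilinearSeries h1.analyticAt.hasFPowerSeriesAt
  have h3 := congrArg (fun q => FormalMultilinearSeries.coeff q k) h2
  simpa using h3

end

end Platoon

namespace Platoon

noncomputable section

/-! ### Counts of a Poisson process -/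

section Poisson

variable {Ω : Type*} [MeasurableSpace Ω] {P : Measure Ω} {z : ℕ → Ω → ℝ} {lam : ℝ} {B : Set ℝ}

theorem measurable_encard_setOf {α ι : Type*} [MeasurableSpace α] [Countable ι] {S : ι → Set α}
    (hS : ∀ i, MeasurableSet (S i)) : Measurable fun a => {i | a ∈ S i}.encard :=
  measurable_encard.comp (measurable_set_iff.2 fun i => measurable_mem.2 (hS i))

theorem measurable_count (hz : ∀ i, Measurable (z i)) (hB : MeasurableSet B) :
    Measurable (count z B) :=
  measurable_encard_setOf (S := fun i => z i ⁻¹' B) fun i => hz i hB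

theorem toENNReal_encard_eq_tsum {ι : Type*} (s : Set ι) :
    (s.encard : ℝ≥0∞) = ∑' i, s.indicator 1 i := by
  rw [← ENNReal.tsum_set_one, tsum_subtype s (fun _ => (1 : ℝ≥0∞))]
  rfl

/-- Campbell's formula for an indicator: the count is the sum of the indicators of its points, and
nonnegative sums commute with expectation. -/
theorem tsum_measure_preimage_eq_lintegral_count (hz : ∀ i, Measurable (z i))
    (hB : MeasurableSet B) : ∑' i, P {ω | z i ω ∈ B} = ∫⁻ ω, (count z B ω : ℝ≥0∞) ∂P := by
  simp_rw [count, toENNReal_encard_eq_tsum]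
  rw [lintegral_tsum]
  · refine tsum_congr fun i => ?_
    exact (lintegral_indicator_one (hz i hB)).symm
  · exact fun i => (measurable_one.indicator (hz i hB)).aemeasurable

theorem lintegral_poissonMeasure_natCast (r : ℝ≥0) :
    ∫⁻ n, (n : ℝ≥0∞) ∂(poissonMeasure r) = r := by
  rw [lintegral_countable', tsum_eq_zero_add' ENNReal.summable]
  have h : ∀ n : ℕ, ((n + 1 : ℕ) : ℝ≥0∞) * poissonMeasure r {n + 1} = r * poissonMeasure r {n} := by
    intro n
    rw [poissonMeasure_singleton, poissonMeasure_singleton, ← ENNReal.ofReal_natCast,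
      ← ENNReal.ofReal_coe_nnreal, ← ENNReal.ofReal_mul (by positivity),
      ← ENNReal.ofReal_mul (by positivity), Nat.factorial_succ]
    congr 1
    push_cast
    field_simp
    ring
  simp_rw [h]
  have h1 : ∑' n, poissonMeasure r {n} = 1 := by
    have := lintegral_countable' (μ := poissonMeasure r) (fun _ => (1 : ℝ≥0∞))
    simpa using this.symm
  rw [ENNReal.tsum_mul_left, h1]
  simp

namespace IsPoissonProcess

/-- The definition fixes only the probabilities of the finite values. They already sum to one, so no
mass is left for `⊤`, and domination with equal total mass forces equality. -/
theorem map_count [IsProbabilityMeasure P] (hz : IsPoissonProcess P z lam) (hB : MeasurableSet B)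
    (hB1 : volume B ≠ ∞) :
    P.map (count z B) =
      (poissonMeasure (lam.toNNReal * (volume B).toNNReal)).map (fun n : ℕ => (n : ℕ∞)) := by
  set ρ := lam.toNNReal * (volume B).toNNReal
  have hm := measurable_count hz.measurable hB
  have h1 : ∀ n : ℕ, P.map (count z B) {(n : ℕ∞)} = poissonMeasure ρ {n} := fun n => by
    rw [Measure.map_apply hm (measurableSet_singleton _)]
    exact hz.count_law B hB hB1 n
  have h2 : ∀ n : ℕ, (poissonMeasure ρ).map (fun n : ℕ => (n : ℕ∞)) {(n : ℕ∞)} =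
      poissonMeasure ρ {n} := fun n => by
    rw [Measure.map_apply .of_discrete (measurableSet_singleton _)]
    congr 1
    ext k
    simp
  have : IsProbabilityMeasure (P.map (count z B)) := Measure.isProbabilityMeasure_map hm.aemeasurable
  refine (Measure.eq_of_le_of_measure_univ_eq (μ := (poissonMeasure ρ).map _) ?_ ?_).symm
  · refine Measure.le_iff.2 fun s _ => ?_
    rw [Measure.map_apply .of_discrete .of_discrete,
      ← Measure.tsum_indicator_apply_singleton _ _ .of_discrete]
    calc ∑' n, ((fun n : ℕ => (n : ℕ∞)) ⁻¹' s).indicator (fun x => poissonMeasure ρ {x}) n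
        = ∑' n : ℕ, s.indicator (fun x => P.map (count z B) {x}) (n : ℕ∞) := by
          refine tsum_congr fun n => ?_
          simp only [indicator, h1]
          rfl
      _ ≤ ∑' x, s.indicator (fun x => P.map (count z B) {x}) x :=
          ENNReal.tsum_comp_le_tsum_of_injective Nat.cast_injective _
      _ = P.map (count z B) s := Measure.tsum_indicator_apply_singleton _ _ .of_discrete
  · have h3 : IsProbabilityMeasure ((poissonMeasure ρ).map (fun n : ℕ => (n : ℕ∞))) :=
      Measure.isProbabilityMeasure_map .of_discrete
    rw [h3.measure_univ, this.measure_univ]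

theorem lintegral_count [IsProbabilityMeasure P] (hz : IsPoissonProcess P z lam) (hB : MeasurableSet B)
    (hB1 : volume B ≠ ∞) :
    ∫⁻ ω, (count z B ω : ℝ≥0∞) ∂P = ENNReal.ofReal lam * volume B := by
  rw [← lintegral_map (f := fun n : ℕ∞ => (n : ℝ≥0∞)) .of_discrete
    (measurable_count hz.measurable hB), hz.map_count hB hB1,
    lintegral_map .of_discrete .of_discrete]
  simp only [ENat.toENNReal_coe, lintegral_poissonMeasure_natCast]
  rw [ENNReal.coe_mul, ENNReal.coe_toNNReal hB1]
  rfl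

theorem ae_count_ne_top [IsProbabilityMeasure P] (hz : IsPoissonProcess P z lam) (hB : MeasurableSet B)
    (hB1 : volume B ≠ ∞) : ∀ᵐ ω ∂P, count z B ω ≠ ⊤ := by
  have h := ae_lt_top (f := fun ω => (count z B ω : ℝ≥0∞))
    ((Measurable.of_discrete (f := fun n : ℕ∞ => (n : ℝ≥0∞))).comp
      (measurable_count hz.measurable hB))
    (by rw [hz.lintegral_count hB hB1]; exact ENNReal.mul_ne_top ENNReal.ofReal_ne_top hB1)
  filter_upwards [h] with ω hω
  simpa [lt_top_iff_ne_top] using hω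

theorem measure_count_eq_zero (hz : IsPoissonProcess P z lam) (hlam : 0 ≤ lam)
    (hB : MeasurableSet B) (hB1 : volume B ≠ ∞) :
    P {ω | count z B ω = 0} = ENNReal.ofReal (Real.exp (-(lam * volume.real B))) := by
  have h := hz.count_law B hB hB1 0
  rw [poissonMeasure_singleton] at h
  simp only [Nat.cast_zero] at h
  rw [h]
  simp [Real.coe_toNNReal _ hlam, Measure.real, ENNReal.coe_toNNReal_eq_toReal]

theorem measure_count_eq_one (hz : IsPoissonProcess P z lam) (hlam : 0 ≤ lam)
    (hB : MeasurableSet B) (hB1 : volume B ≠ ∞) :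
    P {ω | count z B ω = 1} =
      ENNReal.ofReal (Real.exp (-(lam * volume.real B)) * (lam * volume.real B)) := by
  have h := hz.count_law B hB hB1 1
  rw [poissonMeasure_singleton] at h
  simp only [Nat.cast_one] at h
  rw [h]
  simp [Real.coe_toNNReal _ hlam, Measure.real, ENNReal.coe_toNNReal_eq_toReal]

theorem indepFun_count (hz : IsPoissonProcess P z lam) {C : Set ℝ} (hB : MeasurableSet B)
    (hC : MeasurableSet C) (hBC : Disjoint B C) : IndepFun (count z B) (count z C) P := by
  have h := hz.count_indep 2 ![B, C] (by simp [Fin.forall_fin_two, hB, hC]) (by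
    intro i j hij
    fin_cases i <;> fin_cases j <;> simp_all [disjoint_comm])
  simpa using h.indepFun (show (0 : Fin 2) ≠ 1 by decide)

end IsPoissonProcess

end Poisson

theorem integral_poissonMeasure_pow (r : ℝ≥0) (s : ℝ) :
    ∫ n, s ^ n ∂(poissonMeasure r) = Real.exp (r * (s - 1)) := by
  rw [integral_poissonMeasure]
  have h := (NormedSpace.expSeries_div_hasSum_exp (r * s : ℝ)).mul_left (Real.exp (-r))
  rw [← Real.exp_eq_exp_ℝ, ← Real.exp_add] at h
  rw [show (r : ℝ) * (s - 1) = -r + r * s by ring, ← h.tsum_eq]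
  refine tsum_congr fun n => ?_
  rw [mul_pow, smul_eq_mul]
  ring

end

end Platoon

namespace Platoon

noncomputable section

/-! ### The distances to the neighbours of a point of a Poisson process -/

/-- The distance from the point `y i` to the next point of the configuration `y` on its right
(zero if `y i` is a multiple point). -/
def rightGap (y : ℕ → ℝ) (i : ℕ) : ℝ≥0∞ :=
  ⨅ j, if j ≠ i ∧ y i ≤ y j then ENNReal.ofReal (y j - y i) else ⊤

/-- The distance from the point `y i` to the next point of the configuration `y` on its left. -/
def leftGap (y : ℕ → ℝ) (i : ℕ) : ℝ≥0∞ := rightGap (fun j => -y j) i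

theorem measurable_rightGap (i : ℕ) : Measurable fun y => rightGap y i := by
  refine Measurable.iInf fun j => Measurable.ite ?_ (by fun_prop) measurable_const
  by_cases hj : j = i
  · simp [hj]
  · simpa [hj] using measurableSet_le (measurable_pi_apply i) (measurable_pi_apply j)

theorem measurable_leftGap (i : ℕ) : Measurable fun y => leftGap y i :=
  (measurable_rightGap i).comp (f := fun (y : ℕ → ℝ) j => -y j) (by fun_prop)

/-- Lower bounds on an infimum are universal statements, so no nearest neighbour has to be
exhibited. Negative u causes no trouble because the competing differences are nonnegative. -/
theorem ofReal_le_rightGap_iff {y : ℕ → ℝ} {i : ℕ} {u : ℝ} :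
    ENNReal.ofReal u ≤ rightGap y i ↔ ∀ j ≠ i, y i ≤ y j → u ≤ y j - y i := by
  rw [rightGap, le_iInf_iff]
  refine forall_congr' fun j => ?_
  by_cases h : j ≠ i ∧ y i ≤ y j
  · rw [if_pos h, ENNReal.ofReal_le_ofReal_iff (sub_nonneg.2 h.2)]
    tauto
  · rw [if_neg h]
    simp only [le_top, true_iff]
    tauto

theorem ofReal_le_leftGap_iff {y : ℕ → ℝ} {i : ℕ} {v : ℝ} :
    ENNReal.ofReal v ≤ leftGap y i ↔ ∀ j ≠ i, y j ≤ y i → v ≤ y i - y j := by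
  rw [leftGap, ofReal_le_rightGap_iff]
  refine forall₂_congr fun j _ => ?_
  rw [neg_le_neg_iff, neg_sub_neg]

section Gaps

variable {Ω : Type*} [MeasurableSpace Ω] {P : Measure Ω} {z : ℕ → Ω → ℝ} {lam : ℝ}

/-- The event that the gaps on the right and on the left of the point `z i` are at least
`u` and `v`. -/
def gapEvent (z : ℕ → Ω → ℝ) (u v : ℝ) (i : ℕ) : Set Ω :=
  {ω | ENNReal.ofReal u ≤ rightGap (fun j => z j ω) i ∧
    ENNReal.ofReal v ≤ leftGap (fun j => z j ω) i}

theorem measurableSet_gapEvent (hz : ∀ i, Measurable (z i)) (u v : ℝ) (i : ℕ) :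
    MeasurableSet (gapEvent z u v i) := by
  have h : Measurable fun ω => (fun j => z j ω) := measurable_pi_iff.2 hz
  exact (measurableSet_le measurable_const ((measurable_rightGap i).comp h)).inter
    (measurableSet_le measurable_const ((measurable_leftGap i).comp h))

namespace IsPoissonProcess

/-- If a point of the short window has gaps at least u and v, then the set G of locations outside
the window that are within those distances of every point of the window must be empty. G has length
at least u + v - 2h and its count is independent of the count in W. -/
theorem tsum_measure_inter_gapEvent_le [IsProbabilityMeasure P]
    (hz : IsPoissonProcess P z lam) (hlam : 0 ≤ lam)
    {u v h c : ℝ} {W : Set ℝ} (hW : MeasurableSet W) (hWc : W ⊆ Ico c (c + h)) :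
    ∑' i, P ({ω | z i ω ∈ W} ∩ gapEvent z u v i) ≤
      ENNReal.ofReal lam * volume W * ENNReal.ofReal (Real.exp (-(lam * (u + v - 2 * h)))) := by
  have hW1 : volume W ≠ ∞ := ((measure_mono hWc).trans_lt measure_Ico_lt_top).ne
  set G := Ico (c + h - v) c ∪ Ico (c + h) (c + u) with hG
  have hGm : MeasurableSet G := measurableSet_Ico.union measurableSet_Ico
  have hG1 : volume G ≠ ∞ :=
    ((measure_union_le _ _).trans_lt
      (ENNReal.add_lt_top.2 ⟨measure_Ico_lt_top, measure_Ico_lt_top⟩)).ne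
  have hGr : u + v - 2 * h ≤ volume.real G ∨ h < 0 := by
    by_cases hh : h < 0
    · exact Or.inr hh
    left
    rw [hG, measureReal_union ?_ measurableSet_Ico measure_Ico_lt_top.ne measure_Ico_lt_top.ne,
      Real.volume_real_Ico, Real.volume_real_Ico]
    · linarith [le_max_left (c - (c + h - v)) 0, le_max_left (c + u - (c + h)) 0]
    · refine Set.disjoint_left.2 fun t ht ht' => ?_
      linarith [ht.2, ht'.1]
  have hdisj : Disjoint W G := by
    refine Set.disjoint_left.2 fun t ht ht' => ?_
    have h1 := hWc ht
    rcases ht' with h2 | h2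
    · linarith [h1.1, h2.2]
    · linarith [h1.2, h2.1]
  rcases hGr with hGr | hh
  swap
  · have : W = ∅ := by
      rw [Set.eq_empty_iff_forall_notMem]
      intro t ht
      linarith [(hWc ht).1, (hWc ht).2]
    simp [this]
  have hsub : ∀ i, {ω | z i ω ∈ W} ∩ gapEvent z u v i ⊆
      {ω | z i ω ∈ W} ∩ {ω | count z G ω = 0} := by
    rintro i ω ⟨hi, hR, hL⟩
    refine ⟨hi, ?_⟩
    rw [ofReal_le_rightGap_iff] at hR
    rw [ofReal_le_leftGap_iff] at hL
    have hi' := hWc hi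
    rw [mem_ofPred_eq, count, Set.encard_eq_zero, Set.eq_empty_iff_forall_notMem]
    intro j hj
    have hji : j ≠ i := by
      rintro rfl
      exact Set.disjoint_left.1 hdisj hi hj
    rcases hj with hj | hj
    · linarith [hL j hji (hj.2.le.trans hi'.1), hj.1, hi'.2]
    · linarith [hR j hji (hi'.2.le.trans hj.1), hj.2, hi'.1]
  have hmW := measurable_count hz.measurable hW
  have hmG := measurable_count hz.measurable hGm
  have hevG : MeasurableSet {ω | count z G ω = 0} := hmG (measurableSet_singleton 0)
  calc ∑' i, P ({ω | z i ω ∈ W} ∩ gapEvent z u v i)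
      ≤ ∑' i, P ({ω | z i ω ∈ W} ∩ {ω | count z G ω = 0}) :=
        ENNReal.tsum_le_tsum fun i => measure_mono (hsub i)
    _ = ∑' i, (P.restrict {ω | count z G ω = 0}) {ω | z i ω ∈ W} := by
        refine tsum_congr fun i => ?_
        exact (Measure.restrict_apply (hz.measurable i hW)).symm
    _ = ∫⁻ ω in {ω | count z G ω = 0}, (count z W ω : ℝ≥0∞) ∂P :=
        tsum_measure_preimage_eq_lintegral_count hz.measurable hW
    _ = ∫⁻ ω, (count z W ω : ℝ≥0∞) * ({0} : Set ℕ∞).indicator 1 (count z G ω) ∂P := by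
        rw [← lintegral_indicator hevG]
        refine lintegral_congr fun ω => ?_
        by_cases h0 : count z G ω = 0 <;> simp [h0]
    _ = (∫⁻ ω, (count z W ω : ℝ≥0∞) ∂P) *
          ∫⁻ ω, ({0} : Set ℕ∞).indicator 1 (count z G ω) ∂P := by
        refine lintegral_mul_eq_lintegral_mul_lintegral_of_indepFun
          ((Measurable.of_discrete (f := fun n : ℕ∞ => (n : ℝ≥0∞))).comp hmW)
          ((Measurable.of_discrete (f := fun n : ℕ∞ =>
            ({0} : Set ℕ∞).indicator (1 : ℕ∞ → ℝ≥0∞) n)).comp hmG) ?_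
        exact (hz.indepFun_count hW hGm hdisj).comp
          (φ := fun n : ℕ∞ => (n : ℝ≥0∞))
          (ψ := fun n : ℕ∞ => ({0} : Set ℕ∞).indicator (1 : ℕ∞ → ℝ≥0∞) n)
          .of_discrete .of_discrete
    _ = ENNReal.ofReal lam * volume W * P {ω | count z G ω = 0} := by
        rw [hz.lintegral_count hW hW1, ← lintegral_indicator_one hevG]
        rfl
    _ ≤ _ := by
        rw [hz.measure_count_eq_zero hlam hGm hG1]
        gcongr

/-- Conversely, if W contains exactly one point and the rest of [c - v, c + h + u] is empty, that
point has the required gaps. The length of W cancels in the exponent of the product of the two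
probabilities. -/
theorem le_tsum_measure_inter_gapEvent (hz : IsPoissonProcess P z lam) (hlam : 0 ≤ lam)
    {u v h c : ℝ} (hu : 0 ≤ u) (hv : 0 ≤ v) (hh : 0 ≤ h)
    {W : Set ℝ} (hW : MeasurableSet W) (hWc : W ⊆ Ico c (c + h)) :
    ENNReal.ofReal lam * volume W * ENNReal.ofReal (Real.exp (-(lam * (u + v + h)))) ≤
      ∑' i, P ({ω | z i ω ∈ W} ∩ gapEvent z u v i) := by
  have hW1 : volume W ≠ ∞ := ((measure_mono hWc).trans_lt measure_Ico_lt_top).ne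
  set C := Icc (c - v) (c + h + u) \ W with hC
  have hCm : MeasurableSet C := measurableSet_Icc.diff hW
  have hC1 : volume C ≠ ∞ := ((measure_mono sdiff_subset).trans_lt measure_Icc_lt_top).ne
  have hWsub : W ⊆ Icc (c - v) (c + h + u) := fun t ht =>
    ⟨by linarith [(hWc ht).1], by linarith [(hWc ht).2]⟩
  have hCr : volume.real C = u + v + h - volume.real W := by
    rw [hC, measureReal_sdiff hWsub hW measure_Icc_lt_top.ne, Real.volume_real_Icc,
      max_eq_left (by linarith)]
    ring
  have hsub : {ω | count z W ω = 1} ∩ {ω | count z C ω = 0} ⊆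
      ⋃ i, {ω | z i ω ∈ W} ∩ gapEvent z u v i := by
    rintro ω ⟨h1, h0⟩
    rw [mem_ofPred_eq, count, Set.encard_eq_one] at h1
    obtain ⟨i, hi⟩ := h1
    rw [mem_ofPred_eq, count, Set.encard_eq_zero, Set.eq_empty_iff_forall_notMem] at h0
    have hiW : z i ω ∈ W := by
      have : i ∈ {i | z i ω ∈ W} := by rw [hi]; rfl
      exact this
    have hnot : ∀ j ≠ i, z j ω ∉ Icc (c - v) (c + h + u) := by
      intro j hj hjc
      refine h0 j ⟨hjc, fun hjW => hj ?_⟩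
      have : j ∈ {i | z i ω ∈ W} := hjW
      rw [hi] at this
      exact this
    have hic := hWc hiW
    refine mem_iUnion.2 ⟨i, hiW, ?_, ?_⟩
    · rw [ofReal_le_rightGap_iff]
      intro j hj hij
      by_contra! hlt
      exact hnot j hj ⟨by linarith [hic.1], by linarith [hic.2]⟩
    · rw [ofReal_le_leftGap_iff]
      intro j hj hij
      by_contra! hlt
      exact hnot j hj ⟨by linarith [hic.1], by linarith [hic.2]⟩
  calc ENNReal.ofReal lam * volume W * ENNReal.ofReal (Real.exp (-(lam * (u + v + h))))
      = P {ω | count z W ω = 1} * P {ω | count z C ω = 0} := by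
        rw [hz.measure_count_eq_one hlam hW hW1, hz.measure_count_eq_zero hlam hCm hC1, hCr,
          ← ENNReal.ofReal_mul (by positivity), ← ENNReal.ofReal_toReal hW1,
          ← ENNReal.ofReal_mul hlam, ← ENNReal.ofReal_mul (by positivity)]
        have hexp : Real.exp (-(lam * (u + v + h))) = Real.exp (-(lam * volume.real W)) *
            Real.exp (-(lam * (u + v + h - volume.real W))) := by
          rw [← Real.exp_add]
          congr 1
          ring
        rw [hexp]
        simp only [Measure.real]
        congr 1
        ring
    _ = P ({ω | count z W ω = 1} ∩ {ω | count z C ω = 0}) :=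
        ((hz.indepFun_count hW hCm disjoint_sdiff_right).measure_inter_preimage_eq_mul {1} {0}
          (measurableSet_singleton _) (measurableSet_singleton _)).symm
    _ ≤ _ := (measure_mono hsub).trans (measure_iUnion_le _)

/-- The gaps on the two sides of the typical point of a Poisson process are independent and
exponentially distributed. -/
theorem tsum_measure_inter_gapEvent [IsProbabilityMeasure P]
    (hz : IsPoissonProcess P z lam) (hlam : 0 ≤ lam)
    {u v : ℝ} (hu : 0 ≤ u) (hv : 0 ≤ v) {B : Set ℝ} (hB : MeasurableSet B)
    (hB1 : volume B ≠ ∞) :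
    ∑' i, P ({ω | z i ω ∈ B} ∩ gapEvent z u v i) =
      ENNReal.ofReal lam * volume B * ENNReal.ofReal (Real.exp (-(lam * (u + v)))) := by
  -- Both bounds are proportional to the volume of W, so they add up over the pieces of B in a grid
  -- of mesh h; letting h tend to 0 closes the gap between them.
  have hdec : ∀ (h : ℝ), 0 < h → ∀ μ : Measure ℝ,
      μ B = ∑' k : ℤ, μ (B ∩ Ico (k • h) ((k + 1) • h)) := by
    intro h hh μ
    rw [← measure_iUnion, ← inter_iUnion, iUnion_Ico_zsmul hh, inter_univ]
    · intro k l hkl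
      exact (Set.pairwise_disjoint_Ico_zsmul h hkl).mono inter_subset_right inter_subset_right
    · exact fun k => hB.inter measurableSet_Ico
  have hsum : ∀ (h : ℝ), 0 < h → ∑' i, P ({ω | z i ω ∈ B} ∩ gapEvent z u v i) =
      ∑' k : ℤ, ∑' i, P ({ω | z i ω ∈ B ∩ Ico (k • h) ((k + 1) • h)} ∩ gapEvent z u v i) := by
    intro h hh
    rw [ENNReal.tsum_comm]
    refine tsum_congr fun i => ?_
    have h1 : ∀ S, MeasurableSet S → P ({ω | z i ω ∈ S} ∩ gapEvent z u v i) =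
        ((P.restrict (gapEvent z u v i)).map (z i)) S := fun S hS => by
      rw [Measure.map_apply (hz.measurable i) hS, Measure.restrict_apply (hz.measurable i hS)]
      rfl
    rw [h1 B hB, hdec h hh]
    exact tsum_congr fun k => (h1 _ (hB.inter measurableSet_Ico)).symm
  have hlow : ∀ h : ℝ, 0 < h →
      ENNReal.ofReal lam * volume B * ENNReal.ofReal (Real.exp (-(lam * (u + v + h)))) ≤
      ∑' i, P ({ω | z i ω ∈ B} ∩ gapEvent z u v i) := by
    intro h hh
    rw [hsum h hh, hdec h hh volume, ← ENNReal.tsum_mul_left, ← ENNReal.tsum_mul_right]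
    refine ENNReal.tsum_le_tsum fun k => hz.le_tsum_measure_inter_gapEvent hlam hu hv hh.le
      (c := k • h) (hB.inter measurableSet_Ico) ?_
    rw [add_smul, one_smul]
    exact inter_subset_right
  have hupp : ∀ h : ℝ, 0 < h → ∑' i, P ({ω | z i ω ∈ B} ∩ gapEvent z u v i) ≤
      ENNReal.ofReal lam * volume B * ENNReal.ofReal (Real.exp (-(lam * (u + v - 2 * h)))) := by
    intro h hh
    rw [hsum h hh, hdec h hh volume, ← ENNReal.tsum_mul_left, ← ENNReal.tsum_mul_right]
    refine ENNReal.tsum_le_tsum fun k => hz.tsum_measure_inter_gapEvent_le hlam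
      (c := k • h) (hB.inter measurableSet_Ico) ?_
    rw [add_smul, one_smul]
    exact inter_subset_right
  have hlim : ∀ d : ℝ, Filter.Tendsto (fun h : ℝ => ENNReal.ofReal lam * volume B *
      ENNReal.ofReal (Real.exp (-(lam * (u + v + d * h))))) (nhdsWithin 0 (Ioi 0))
      (nhds (ENNReal.ofReal lam * volume B * ENNReal.ofReal (Real.exp (-(lam * (u + v)))))) := by
    intro d
    refine ENNReal.Tendsto.const_mul ?_ (Or.inr (ENNReal.mul_ne_top ENNReal.ofReal_ne_top hB1))
    refine (ENNReal.continuous_ofReal.tendsto _).comp (Filter.Tendsto.mono_left ?_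
      nhdsWithin_le_nhds)
    have : Continuous fun h : ℝ => Real.exp (-(lam * (u + v + d * h))) := by fun_prop
    simpa using this.tendsto 0
  refine le_antisymm (ge_of_tendsto (hlim (-2)) ?_) (le_of_tendsto (hlim 1) ?_)
  · filter_upwards [self_mem_nhdsWithin] with h hh
    refine (hupp h hh).trans (le_of_eq ?_)
    congr 6
    ring
  · filter_upwards [self_mem_nhdsWithin] with h hh
    simpa using hlow h hh

end IsPoissonProcess

end Gaps

end

end Platoon

namespace Platoon

noncomputable section

/-! ### The law of the length of the typical cell -/

theorem expMeasure_Ici {lam : ℝ} (hlam : 0 < lam) (u : ℝ) :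
    expMeasure lam (Ici u) = ENNReal.ofReal (Real.exp (-(lam * max u 0))) := by
  have := isProbabilityMeasure_expMeasure hlam
  have : NullSingletonClass (expMeasure lam) := by
    unfold expMeasure gammaMeasure
    infer_instance
  rw [measure_congr (Ioi_ae_eq_Ici (μ := expMeasure lam)).symm, ← compl_Iic,
    prob_compl_eq_one_sub measurableSet_Iic, ← ofReal_cdf, cdf_expMeasure_eq hlam,
    ← ENNReal.ofReal_one, ← ENNReal.ofReal_sub]
  · congr 1
    split_ifs with h
    · rw [max_eq_left h]
      ring
    · rw [max_eq_right (not_le.1 h).le]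
      simp
  · split_ifs with h
    · rw [sub_nonneg, Real.exp_le_one_iff]
      have := mul_nonneg hlam.le h
      linarith
    · exact le_rfl

theorem exponentialPDF_mul_exponentialPDF_sub (lam : ℝ) (u w : ℝ) :
    exponentialPDF lam u * exponentialPDF lam (w - u) =
      (Icc 0 w).indicator (fun u => ENNReal.ofReal (lam * Real.exp (-(lam * u))) *
        ENNReal.ofReal (lam * Real.exp (-(lam * (w - u))))) u := by
  rw [exponentialPDF_eq, exponentialPDF_eq]
  by_cases h0 : 0 ≤ u <;> by_cases h1 : u ≤ w <;> simp [h0, h1]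

/-- The half sum of two independent exponential variables has a Gamma distribution. -/
theorem lintegral_half_add_expMeasure {lam : ℝ} (hlam : 0 < lam) {F : ℝ → ℝ≥0∞}
    (hF : Measurable F) :
    ∫⁻ p, F ((p.1 + p.2) / 2) ∂((expMeasure lam).prod (expMeasure lam)) =
      ∫⁻ t in Ioi 0, F t * ENNReal.ofReal (fL lam t) := by
  have := isProbabilityMeasure_expMeasure hlam
  have he : Measurable (exponentialPDF lam) :=
    (measurable_exponentialPDFReal lam).ennreal_ofReal
  have hexp : expMeasure lam = volume.withDensity (exponentialPDF lam) := rfl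
  have h1 : ∀ u : ℝ, ∫⁻ v, F ((u + v) / 2) ∂(expMeasure lam) =
      ∫⁻ w, exponentialPDF lam (w - u) * F (w / 2) := by
    intro u
    rw [hexp, lintegral_withDensity_eq_lintegral_mul _ he (by fun_prop),
      ← lintegral_sub_right_eq_self _ u]
    refine lintegral_congr fun w => ?_
    simp
  have h2 : ∀ w : ℝ, ∫⁻ u, exponentialPDF lam u * exponentialPDF lam (w - u) =
      ENNReal.ofReal (lam ^ 2 * Real.exp (-(lam * w)) * w) := by
    intro w
    simp_rw [exponentialPDF_mul_exponentialPDF_sub]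
    rw [lintegral_indicator measurableSet_Icc]
    have : ∀ u : ℝ, ENNReal.ofReal (lam * Real.exp (-(lam * u))) *
        ENNReal.ofReal (lam * Real.exp (-(lam * (w - u)))) =
        ENNReal.ofReal (lam ^ 2 * Real.exp (-(lam * w))) := by
      intro u
      rw [← ENNReal.ofReal_mul (by positivity), mul_mul_mul_comm, ← Real.exp_add]
      congr 2
      · ring
      · congr 1
        ring
    simp_rw [this]
    rw [setLIntegral_const, Real.volume_Icc, sub_zero, ← ENNReal.ofReal_mul (by positivity)]
  -- Substitution w = 2t, passing from the sum of the two variables to their half sum.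
  have h3 : (volume : Measure ℝ) = ENNReal.ofReal 2 • Measure.map (fun x => 2 * x) volume := by
    have := Real.smul_map_volume_mul_left (a := 2) two_ne_zero
    rw [abs_of_pos two_pos] at this
    exact this.symm
  calc ∫⁻ p, F ((p.1 + p.2) / 2) ∂((expMeasure lam).prod (expMeasure lam))
      = ∫⁻ u, ∫⁻ v, F ((u + v) / 2) ∂(expMeasure lam) ∂(expMeasure lam) :=
        lintegral_prod _ (by fun_prop)
    _ = ∫⁻ u, exponentialPDF lam u * ∫⁻ w, exponentialPDF lam (w - u) * F (w / 2) := by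
        simp_rw [h1]
        rw [hexp, lintegral_withDensity_eq_lintegral_mul _ he]
        · rfl
        · exact Measurable.lintegral_prod_right' (f := fun p : ℝ × ℝ =>
            exponentialPDF lam (p.2 - p.1) * F (p.2 / 2)) (by fun_prop)
    _ = ∫⁻ u, ∫⁻ w, exponentialPDF lam u * (exponentialPDF lam (w - u) * F (w / 2)) := by
        refine lintegral_congr fun u => ?_
        rw [lintegral_const_mul _ (by fun_prop)]
    _ = ∫⁻ w, ∫⁻ u, exponentialPDF lam u * (exponentialPDF lam (w - u) * F (w / 2)) :=
        lintegral_lintegral_swap (by fun_prop)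
    _ = ∫⁻ w, ENNReal.ofReal (lam ^ 2 * Real.exp (-(lam * w)) * w) * F (w / 2) := by
        refine lintegral_congr fun w => ?_
        simp_rw [← mul_assoc]
        rw [lintegral_mul_const _ (by fun_prop), h2]
    _ = ENNReal.ofReal 2 * ∫⁻ t, ENNReal.ofReal (lam ^ 2 * Real.exp (-(lam * (2 * t))) * (2 * t)) *
          F ((2 * t) / 2) := by
        conv_lhs => rw [h3]
        rw [lintegral_smul_measure, lintegral_map (by fun_prop) (by fun_prop), smul_eq_mul]
    _ = ∫⁻ t, F t * ENNReal.ofReal (fL lam t) := by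
        rw [← lintegral_const_mul _ (by fun_prop)]
        refine lintegral_congr fun t => ?_
        rw [mul_div_cancel_left₀ t two_ne_zero, ← mul_assoc, ← ENNReal.ofReal_mul two_pos.le,
          mul_comm, fL]
        congr 2
        rw [show -(lam * (2 * t)) = -2 * lam * t by ring]
        ring
    -- For t ≤ 0 the expression `fL lam t` is nonpositive, so `ENNReal.ofReal` discards it and the
    -- integral reduces to the half-line.
    _ = _ := by
        rw [← lintegral_indicator measurableSet_Ioi]
        refine lintegral_congr fun t => ?_
        by_cases ht : 0 < t
        · simp [ht]
        · have : fL lam t ≤ 0 := by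
            rw [fL, show 4 * lam ^ 2 * t * Real.exp (-2 * lam * t) =
              4 * lam ^ 2 * Real.exp (-2 * lam * t) * t by ring]
            exact mul_nonpos_of_nonneg_of_nonpos (by positivity) (not_lt.1 ht)
          simp [ht, ENNReal.ofReal_of_nonpos this]

/-- The distances from the point `y i` to the next points on its right and on its left. -/
def gaps (y : ℕ → ℝ) (i : ℕ) : ℝ × ℝ := ((rightGap y i).toReal, (leftGap y i).toReal)

theorem measurable_gaps (i : ℕ) : Measurable fun y => gaps y i :=
  (measurable_rightGap i).ennreal_toReal.prodMk (measurable_leftGap i).ennreal_toReal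

/-- The cell of a point with finite positive gaps is an interval. -/
theorem cell_eq_Icc {Ω : Type*} {z : ℕ → Ω → ℝ} {ω : Ω} {i : ℕ} (hR : rightGap (fun j => z j ω) i ≠ ⊤)
    (hL : leftGap (fun j => z j ω) i ≠ ⊤) (hR0 : 0 < (gaps (fun j => z j ω) i).1)
    (hL0 : 0 < (gaps (fun j => z j ω) i).2) :
    cell z i ω = Icc (z i ω - (gaps (fun j => z j ω) i).2 / 2)
      (z i ω + (gaps (fun j => z j ω) i).1 / 2) := by
  set R := (gaps (fun j => z j ω) i).1 with hRdef
  set L := (gaps (fun j => z j ω) i).2 with hLdef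
  have hR1 : ∀ u : ℝ, u ≤ R ↔ ∀ j ≠ i, z i ω ≤ z j ω → u ≤ z j ω - z i ω := fun u => by
    rw [hRdef, gaps, ← ENNReal.ofReal_le_iff_le_toReal hR, ofReal_le_rightGap_iff]
  have hL1 : ∀ u : ℝ, u ≤ L ↔ ∀ j ≠ i, z j ω ≤ z i ω → u ≤ z i ω - z j ω := fun u => by
    rw [hLdef, gaps, ← ENNReal.ofReal_le_iff_le_toReal hL, ofReal_le_leftGap_iff]
  ext y
  rw [cell, mem_ofPred_eq, mem_Icc]
  constructor
  · intro h
    constructor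
    -- If y is farther than L / 2 to the left, some z j has L ≤ z i - z j < 2 (z i - y). As L > 0,
    -- it lies strictly to the left of z i and is strictly nearer to y. The other endpoint is
    -- symmetric.
    · by_contra! hlt
      have : ¬ (2 * (z i ω - y) ≤ L) := by linarith
      rw [hL1] at this
      push Not at this
      obtain ⟨j, hj, hji, hlt'⟩ := this
      have h1 := (hL1 L).1 le_rfl j hj hji
      have h2 := h j
      rw [abs_of_nonpos (by linarith)] at h2
      have h3 : |y - z j ω| < z i ω - y := abs_lt.2 ⟨by linarith, by linarith⟩
      linarith
    · by_contra! hlt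
      have : ¬ (2 * (y - z i ω) ≤ R) := by linarith
      rw [hR1] at this
      push Not at this
      obtain ⟨j, hj, hji, hlt'⟩ := this
      have h1 := (hR1 R).1 le_rfl j hj hji
      have h2 := h j
      rw [abs_of_nonneg (by linarith)] at h2
      have h3 : |y - z j ω| < y - z i ω := abs_lt.2 ⟨by linarith, by linarith⟩
      linarith
  · rintro ⟨h1, h2⟩ j
    by_cases hj : j = i
    · rw [hj]
    rcases le_total (z i ω) (z j ω) with hij | hij
    · have h3 := (hR1 R).1 le_rfl j hj hij
      refine abs_le.2 ⟨?_, ?_⟩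
      · linarith [neg_abs_le (y - z j ω)]
      · linarith [neg_abs_le (y - z j ω)]
    · have h3 := (hL1 L).1 le_rfl j hj hij
      refine abs_le.2 ⟨?_, ?_⟩
      · linarith [le_abs_self (y - z j ω)]
      · linarith [le_abs_self (y - z j ω)]

/-- The gaps of the point `z i` are finite and positive. -/
def goodGaps (y : ℕ → ℝ) (i : ℕ) : Prop :=
  rightGap y i ≠ ⊤ ∧ leftGap y i ≠ ⊤ ∧ 0 < (gaps y i).1 ∧ 0 < (gaps y i).2

theorem goodGaps.cell_eq_closedBall {Ω : Type*} {z : ℕ → Ω → ℝ} {ω : Ω} {i : ℕ} (h : goodGaps (fun j => z j ω) i) :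
    cell z i ω = Metric.closedBall
      (z i ω + ((gaps (fun j => z j ω) i).1 - (gaps (fun j => z j ω) i).2) / 4)
      (((gaps (fun j => z j ω) i).1 + (gaps (fun j => z j ω) i).2) / 2 / 2) := by
  rw [cell_eq_Icc h.1 h.2.1 h.2.2.1 h.2.2.2, Real.closedBall_eq_Icc]
  congr 1 <;> ring

theorem goodGaps.volume_cell {Ω : Type*} {z : ℕ → Ω → ℝ} {ω : Ω} {i : ℕ} (h : goodGaps (fun j => z j ω) i) :
    volume.real (cell z i ω) =
      ((gaps (fun j => z j ω) i).1 + (gaps (fun j => z j ω) i).2) / 2 := by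
  rw [cell_eq_Icc h.1 h.2.1 h.2.2.1 h.2.2.2, Real.volume_real_Icc, max_eq_left]
  · ring
  · linarith [h.2.2.1, h.2.2.2]

section Gaps

variable {Ω : Type*} [MeasurableSpace Ω] {P : Measure Ω} {z : ℕ → Ω → ℝ} {lam : ℝ}

namespace IsPoissonProcess

variable [IsProbabilityMeasure P]

/-- An infinite gap exceeds every u, and the probability of a gap at least u decays exponentially in
u. -/
theorem ae_gap_ne_top (hz : IsPoissonProcess P z lam) (hlam : 0 < lam) {B : Set ℝ}
    (hB : MeasurableSet B) (hB1 : volume B ≠ ∞) (i : ℕ) :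
    ∀ᵐ ω ∂(P.restrict {ω | z i ω ∈ B}),
      rightGap (fun j => z j ω) i ≠ ⊤ ∧ leftGap (fun j => z j ω) i ≠ ⊤ := by
  have hlim : Filter.Tendsto (fun u : ℝ => ENNReal.ofReal lam * volume B *
      ENNReal.ofReal (Real.exp (-(lam * u)))) Filter.atTop (nhds 0) := by
    have h0 : (0 : ℝ≥0∞) = ENNReal.ofReal lam * volume B * ENNReal.ofReal 0 := by simp
    rw [h0]
    refine ENNReal.Tendsto.const_mul ?_ (Or.inr (ENNReal.mul_ne_top ENNReal.ofReal_ne_top hB1))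
    refine (ENNReal.continuous_ofReal.tendsto _).comp ?_
    exact Real.tendsto_exp_neg_atTop_nhds_zero.comp (Filter.tendsto_id.const_mul_atTop hlam)
  have hle : ∀ u v : ℝ, 0 ≤ u → 0 ≤ v →
      P ({ω | z i ω ∈ B} ∩ gapEvent z u v i) ≤
        ENNReal.ofReal lam * volume B * ENNReal.ofReal (Real.exp (-(lam * (u + v)))) :=
    fun u v hu hv => (ENNReal.le_tsum i).trans
      (hz.tsum_measure_inter_gapEvent hlam.le hu hv hB hB1).le
  have hmeas : MeasurableSet {ω | z i ω ∈ B} := hz.measurable i hB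
  rw [Filter.eventually_and, ae_restrict_iff' hmeas, ae_restrict_iff' hmeas, ae_iff, ae_iff]
  constructor
  · refine le_antisymm (ge_of_tendsto hlim ?_) bot_le
    filter_upwards [Filter.eventually_ge_atTop 0] with u hu
    refine (measure_mono ?_).trans ((hle u 0 hu le_rfl).trans (by rw [add_zero]))
    intro ω hω
    simp only [mem_ofPred_eq, Classical.not_imp, ne_eq, not_not] at hω
    exact ⟨hω.1, by rw [hω.2]; exact le_top, by simp⟩
  · refine le_antisymm (ge_of_tendsto hlim ?_) bot_le
    filter_upwards [Filter.eventually_ge_atTop 0] with u hu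
    refine (measure_mono ?_).trans ((hle 0 u le_rfl hu).trans (by rw [zero_add]))
    intro ω hω
    simp only [mem_ofPred_eq, Classical.not_imp, ne_eq, not_not] at hω
    exact ⟨hω.1, by simp, by rw [hω.2]; exact le_top⟩

/-- Only the sum over i is accessible, since the enumeration of the points is arbitrary. The sets
[u, ∞) × [v, ∞) form a generating π-system, and on them the identity is the exponential formula for
gap events; negative u or v are replaced by 0 because gaps are nonnegative. -/
theorem sum_map_gaps (hz : IsPoissonProcess P z lam) (hlam : 0 < lam) {B : Set ℝ}
    (hB : MeasurableSet B) (hB1 : volume B ≠ ∞) :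
    Measure.sum (fun i => (P.restrict {ω | z i ω ∈ B}).map (fun ω => gaps (fun j => z j ω) i)) =
      (ENNReal.ofReal lam * volume B) • (expMeasure lam).prod (expMeasure lam) := by
  have := isProbabilityMeasure_expMeasure hlam
  have hc : ENNReal.ofReal lam * volume B ≠ ∞ := ENNReal.mul_ne_top ENNReal.ofReal_ne_top hB1
  have hzm : Measurable fun ω => (fun j => z j ω) := measurable_pi_iff.2 hz.measurable
  have : IsFiniteMeasure ((ENNReal.ofReal lam * volume B) • expMeasure lam) :=
    ⟨by simp [lt_top_iff_ne_top, hc]⟩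
  have hgen : MeasurableSpace.generateFrom (range Ici) = (inferInstance : MeasurableSpace ℝ) := by
    rw [← borel_eq_generateFrom_Ici]
    exact (BorelSpace.measurable_eq).symm
  have hspan : ∀ μ : Measure ℝ, IsFiniteMeasure μ → μ.FiniteSpanningSetsIn (range Ici) := fun μ _ =>
    { set := fun n => Ici (-(n : ℝ))
      set_mem := fun n => mem_range_self _
      finite := fun n => measure_lt_top _ _
      spanning := by
        rw [eq_univ_iff_forall]
        intro t
        obtain ⟨n, hn⟩ := exists_nat_ge (-t)
        exact mem_iUnion.2 ⟨n, by rw [mem_Ici]; linarith⟩ }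
  rw [← Measure.prod_smul_left]
  refine (Measure.prod_eq_generateFrom hgen hgen isPiSystem_Ici isPiSystem_Ici (hspan _ this)
    (hspan _ inferInstance) ?_).symm
  rintro _ ⟨u, rfl⟩ _ ⟨v, rfl⟩
  have hms : MeasurableSet (Ici u ×ˢ Ici v) := measurableSet_Ici.prod measurableSet_Ici
  rw [Measure.sum_apply _ hms, Measure.smul_apply, expMeasure_Ici hlam, expMeasure_Ici hlam,
    smul_eq_mul, mul_assoc, ← ENNReal.ofReal_mul (by positivity), ← Real.exp_add]
  have h1 := hz.tsum_measure_inter_gapEvent hlam.le (le_max_right u 0) (le_max_right v 0) hB hB1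
  rw [show -(lam * max u 0) + -(lam * max v 0) = -(lam * (max u 0 + max v 0)) by ring, ← h1]
  refine tsum_congr fun i => ?_
  have hgm : Measurable fun ω => gaps (fun j => z j ω) i := (measurable_gaps i).comp hzm
  rw [Measure.map_apply hgm hms,
    inter_comm, ← Measure.restrict_apply (measurableSet_gapEvent hz.measurable _ _ i)]
  refine measure_congr ?_
  filter_upwards [hz.ae_gap_ne_top hlam hB hB1 i] with ω hω
  have hof : ∀ t : ℝ, ENNReal.ofReal (max t 0) = ENNReal.ofReal t := fun t => by
    rcases le_total t 0 with h | h
    · rw [max_eq_right h, ENNReal.ofReal_zero, ENNReal.ofReal_of_nonpos h]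
    · rw [max_eq_left h]
  refine propext ?_
  change (u ≤ (rightGap _ i).toReal ∧ v ≤ (leftGap _ i).toReal) ↔
    (ENNReal.ofReal (max u 0) ≤ _ ∧ ENNReal.ofReal (max v 0) ≤ _)
  rw [hof, hof, ENNReal.ofReal_le_iff_le_toReal hω.1, ENNReal.ofReal_le_iff_le_toReal hω.2]

theorem ae_goodGaps (hz : IsPoissonProcess P z lam) (hlam : 0 < lam) {B : Set ℝ}
    (hB : MeasurableSet B) (hB1 : volume B ≠ ∞) (i : ℕ) :
    ∀ᵐ ω ∂(P.restrict {ω | z i ω ∈ B}), goodGaps (fun j => z j ω) i := by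
  have := isProbabilityMeasure_expMeasure hlam
  have hzm : Measurable fun ω => (fun j => z j ω) := measurable_pi_iff.2 hz.measurable
  have hpos : ∀ᵐ t ∂(expMeasure lam), 0 < t := by
    rw [ae_iff]
    have h : {t : ℝ | ¬ 0 < t} = Iic 0 := by ext; simp
    rw [h, ← ofReal_cdf, cdf_expMeasure_eq hlam]
    simp
  have h1 : ∀ᵐ p ∂(Measure.sum fun i => (P.restrict {ω | z i ω ∈ B}).map
      (fun ω => gaps (fun j => z j ω) i)), 0 < p.1 ∧ 0 < p.2 := by
    rw [hz.sum_map_gaps hlam hB hB1]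
    refine Measure.ae_smul_measure ?_ _
    filter_upwards [Measure.quasiMeasurePreserving_fst.ae hpos,
      Measure.quasiMeasurePreserving_snd.ae hpos] with p hp hp' using ⟨hp, hp'⟩
  rw [Measure.ae_sum_iff] at h1
  have h2 := ae_of_ae_map ((measurable_gaps i).comp hzm).aemeasurable (h1 i)
  filter_upwards [hz.ae_gap_ne_top hlam hB hB1 i, h2] with ω hω hω' using
    ⟨hω.1, hω.2, hω'.1, hω'.2⟩

/-- The law of the length of the typical cell, in integrated form. -/
theorem tsum_lintegral_half_add_gaps (hz : IsPoissonProcess P z lam) (hlam : 0 < lam) {B : Set ℝ}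
    (hB : MeasurableSet B) (hB1 : volume B ≠ ∞) {F : ℝ → ℝ≥0∞} (hF : Measurable F) :
    ∑' i, ∫⁻ ω in {ω | z i ω ∈ B},
        F (((gaps (fun j => z j ω) i).1 + (gaps (fun j => z j ω) i).2) / 2) ∂P =
      ENNReal.ofReal lam * volume B * ∫⁻ t in Ioi 0, F t * ENNReal.ofReal (fL lam t) := by
  have hzm : Measurable fun ω => (fun j => z j ω) := measurable_pi_iff.2 hz.measurable
  have hF2 : Measurable fun p : ℝ × ℝ => F ((p.1 + p.2) / 2) := by fun_prop
  have h := congrArg (fun μ => ∫⁻ p, F ((p.1 + p.2) / 2) ∂μ) (hz.sum_map_gaps hlam hB hB1)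
  rw [lintegral_sum_measure, lintegral_smul_measure, lintegral_half_add_expMeasure hlam hF,
    smul_eq_mul] at h
  rw [← h]
  refine tsum_congr fun i => ?_
  have hgm : Measurable fun ω => gaps (fun j => z j ω) i := (measurable_gaps i).comp hzm
  rw [lintegral_map hF2 hgm]

theorem typicalProb_volume_cell (hz : IsPoissonProcess P z lam) (hlam : 0 < lam) {B : Set ℝ}
    (hB : MeasurableSet B) (hB0 : volume B ≠ 0) (hB1 : volume B ≠ ∞) {A : Set ℝ}
    (hA : MeasurableSet A) :
    typicalProb P z lam B (fun i => {ω | volume.real (cell z i ω) ∈ A}) =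
      ∫⁻ t in A ∩ Ioi 0, ENNReal.ofReal (fL lam t) := by
  have hzm : Measurable fun ω => (fun j => z j ω) := measurable_pi_iff.2 hz.measurable
  have hF : Measurable (A.indicator (1 : ℝ → ℝ≥0∞)) := measurable_one.indicator hA
  have hc0 : ENNReal.ofReal lam * volume B ≠ 0 :=
    mul_ne_zero (by simpa using hlam) hB0
  have hc1 : ENNReal.ofReal lam * volume B ≠ ∞ := ENNReal.mul_ne_top ENNReal.ofReal_ne_top hB1
  have h1 : ∀ i, P ({ω | z i ω ∈ B} ∩ {ω | volume.real (cell z i ω) ∈ A}) =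
      ∫⁻ ω in {ω | z i ω ∈ B}, A.indicator 1
        (((gaps (fun j => z j ω) i).1 + (gaps (fun j => z j ω) i).2) / 2) ∂P := by
    intro i
    have hmeas : MeasurableSet {ω | z i ω ∈ B} := hz.measurable i hB
    have hg := ((measurable_gaps i).comp hzm)
    have hms : MeasurableSet {ω | ((gaps (fun j => z j ω) i).1 +
        (gaps (fun j => z j ω) i).2) / 2 ∈ A} :=
      ((hg.fst.add hg.snd).div_const 2) hA
    -- This form asks for measurability of {z i ∈ B} only; the cell-length event is merely
    -- identified, almost everywhere, with a measurable event about gaps.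
    rw [inter_comm, ← Measure.restrict_apply₀' hmeas.nullMeasurableSet]
    trans P.restrict {ω | z i ω ∈ B} {ω | ((gaps (fun j => z j ω) i).1 +
        (gaps (fun j => z j ω) i).2) / 2 ∈ A}
    · refine measure_congr ?_
      filter_upwards [hz.ae_goodGaps hlam hB hB1 i] with ω hω
      refine propext ?_
      change volume.real (cell z i ω) ∈ A ↔ _ ∈ A
      rw [hω.volume_cell]
    · rw [← lintegral_indicator_one hms]
      rfl
  rw [typicalProb]
  simp_rw [h1]
  rw [hz.tsum_lintegral_half_add_gaps hlam hB hB1 hF, mul_comm, mul_div_assoc,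
    ENNReal.div_self hc0 hc1, mul_one, inter_comm, ← Measure.restrict_restrict measurableSet_Ioi,
    Measure.restrict_restrict measurableSet_Ioi, inter_comm, ← Measure.restrict_restrict hA,
    ← lintegral_indicator hA]
  refine lintegral_congr fun t => ?_
  by_cases ht : t ∈ A <;> simp [ht]

end IsPoissonProcess

end Gaps

end

end Platoon

namespace Platoon

noncomputable section

/-! ### The Laplace functional of a Poisson process -/

section Laplace

variable {Ω : Type*} [MeasurableSpace Ω] {P : Measure Ω} {z : ℕ → Ω → ℝ} {lam : ℝ} {B : Set ℝ}

theorem hasSum_indicator_const {ι : Type*} {T : Set ι} (hT : T.Finite) (c : ℝ) :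
    HasSum (T.indicator fun _ => c) (c * T.encard.toNat) := by
  have h2 : HasSum (T.indicator fun _ => c) (∑ i ∈ hT.toFinset, T.indicator (fun _ => c) i) :=
    hasSum_sum_of_ne_finset_zero fun i hi => by rw [indicator_of_notMem]; simpa using hi
  convert h2 using 1
  rw [Finset.sum_congr rfl (g := fun _ => c) (fun i hi => indicator_of_mem (by simpa using hi) _),
    Finset.sum_const, hT.encard_eq_coe_toFinset_card]
  simp [mul_comm]

namespace IsPoissonProcess

variable [IsProbabilityMeasure P]

theorem integral_exp_neg_mul_count (hz : IsPoissonProcess P z lam) (hlam : 0 ≤ lam)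
    (hB : MeasurableSet B) (hB1 : volume B ≠ ∞) (c : ℝ) :
    ∫ ω, Real.exp (-(c * (count z B ω).toNat)) ∂P =
      Real.exp (-(lam * (volume.real B * (1 - Real.exp (-c))))) := by
  rw [← integral_map (f := fun n : ℕ∞ => Real.exp (-(c * n.toNat)))
    (measurable_count hz.measurable hB).aemeasurable
    (Measurable.of_discrete.aestronglyMeasurable),
    hz.map_count hB hB1, integral_map (Measurable.of_discrete.aemeasurable)
    (Measurable.of_discrete.aestronglyMeasurable)]
  have h : ∀ n : ℕ, Real.exp (-(c * ((n : ℕ∞).toNat : ℝ))) = Real.exp (-c) ^ n := by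
    intro n
    rw [← Real.exp_nat_mul]
    simp [mul_comm]
  simp_rw [h]
  rw [integral_poissonMeasure_pow]
  congr 1
  rw [NNReal.coe_mul, Real.coe_toNNReal _ hlam, ENNReal.coe_toNNReal_eq_toReal, Measure.real]
  ring

/-- The Laplace functional for a function c ∘ ψ with finitely many values. The sum over the points
is almost surely a combination of the counts in the level sets of ψ inside B, which are independent
Poisson variables, so the exponential factors. -/
theorem integral_exp_neg_tsum_of_nat (hz : IsPoissonProcess P z lam) (hlam : 0 ≤ lam)
    (hB : MeasurableSet B) (hB1 : volume B ≠ ∞) {ψ : ℝ → ℕ} (hψ : Measurable ψ) {N : ℕ}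
    (hN : ∀ y, ψ y < N) (hψB : ∀ y ∉ B, ψ y = 0) {c : ℕ → ℝ} (hc0 : c 0 = 0) :
    ∫ ω, Real.exp (-∑' i, c (ψ (z i ω))) ∂P =
      Real.exp (-(lam * ∫ y, (1 - Real.exp (-c (ψ y))))) := by
  set S : Fin N → Set ℝ := fun k => B ∩ ψ ⁻¹' {(k : ℕ)} with hS
  have hSm : ∀ k, MeasurableSet (S k) := fun k => hB.inter (hψ (measurableSet_singleton _))
  have hS1 : ∀ k, volume (S k) ≠ ∞ := fun k =>
    ((measure_mono inter_subset_left).trans_lt hB1.lt_top).ne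
  have hdec : ∀ (F : ℕ → ℝ), F 0 = 0 → ∀ y, F (ψ y) = ∑ k : Fin N, (S k).indicator (fun _ => F k) y := by
    intro F hF0 y
    by_cases hy : y ∈ B
    · rw [Finset.sum_eq_single (⟨ψ y, hN y⟩ : Fin N)]
      · rw [indicator_of_mem]
        exact ⟨hy, rfl⟩
      · intro k _ hk
        rw [indicator_of_notMem]
        rintro ⟨_, hk'⟩
        exact hk (Fin.ext (by simpa using hk'.symm))
      · simp
    · rw [hψB y hy, hF0, Finset.sum_eq_zero]
      intro k _
      rw [indicator_of_notMem]
      exact fun h => hy h.1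
  have hae : ∀ᵐ ω ∂P, ∑' i, c (ψ (z i ω)) = ∑ k : Fin N, c k * (count z (S k) ω).toNat := by
    filter_upwards [ae_all_iff.2 fun k => hz.ae_count_ne_top (hSm k) (hS1 k)] with ω hω
    refine HasSum.tsum_eq ?_
    simp_rw [hdec c hc0]
    exact hasSum_sum fun k _ => hasSum_indicator_const (T := {i | z i ω ∈ S k})
      (Set.encard_ne_top_iff.1 (hω k)) (c k)
  have hint : ∫ y, (1 - Real.exp (-c (ψ y))) =
      ∑ k : Fin N, volume.real (S k) * (1 - Real.exp (-c k)) := by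
    simp_rw [hdec (fun k => 1 - Real.exp (-c k)) (by simp [hc0])]
    rw [integral_finsetSum]
    · refine Finset.sum_congr rfl fun k _ => ?_
      rw [integral_indicator_const _ (hSm k), smul_eq_mul]
    · exact fun k _ => (integrable_indicator_iff (hSm k)).2 (integrableOn_const (hS1 k))
  have hind : iIndepFun (fun k => count z (S k)) P := by
    refine hz.count_indep N S hSm fun k l hkl => ?_
    refine Set.disjoint_left.2 ?_
    rintro y ⟨_, hk⟩ ⟨_, hl⟩
    exact hkl (Fin.ext (hk.symm.trans hl))
  calc ∫ ω, Real.exp (-∑' i, c (ψ (z i ω))) ∂P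
      = ∫ ω, ∏ k : Fin N, Real.exp (-(c k * (count z (S k) ω).toNat)) ∂P := by
        refine integral_congr_ae ?_
        filter_upwards [hae] with ω hω
        rw [hω, ← Real.exp_sum, Finset.sum_neg_distrib]
    _ = ∏ k : Fin N, ∫ ω, Real.exp (-(c k * (count z (S k) ω).toNat)) ∂P :=
        hind.integral_fun_prod_comp (f := fun (k : Fin N) (n : ℕ∞) => Real.exp (-(c k * n.toNat)))
          (fun k => (measurable_count hz.measurable (hSm k)).aemeasurable)
          (fun k => Measurable.of_discrete.aestronglyMeasurable)
    _ = Real.exp (-(lam * ∫ y, (1 - Real.exp (-c (ψ y))))) := by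
        simp_rw [hz.integral_exp_neg_mul_count hlam (hSm _) (hS1 _)]
        rw [← Real.exp_sum, hint, Finset.sum_neg_distrib, Finset.mul_sum]

/-- The Laplace functional of a Poisson process. -/
theorem integral_exp_neg_tsum (hz : IsPoissonProcess P z lam) (hlam : 0 ≤ lam)
    (hB : MeasurableSet B) (hB1 : volume B ≠ ∞) {h : ℝ → ℝ} (hh : Measurable h)
    (h0 : ∀ y, 0 ≤ h y) {M : ℝ} (hM : ∀ y, h y ≤ M) (hhB : ∀ y ∉ B, h y = 0) :
    ∫ ω, Real.exp (-∑' i, h (z i ω)) ∂P =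
      Real.exp (-(lam * ∫ y, (1 - Real.exp (-h y)))) := by
  -- Since h is bounded, rounding down to multiples of 1 / (n + 1) leaves finitely many values. Both
  -- sides converge by dominated convergence, with bounds 1 and the indicator of B.
  set φ : ℕ → ℝ → ℝ := fun n y => (⌊h y * (n + 1 : ℝ)⌋₊ : ℝ) / (n + 1 : ℝ) with hφ
  have hφm : ∀ n, Measurable (φ n) := fun n =>
    ((Measurable.of_discrete (f := fun k : ℕ => (k : ℝ))).comp
      (hh.mul_const _).nat_floor).div_const _
  have hφ0 : ∀ n y, 0 ≤ φ n y := fun n y => by positivity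
  have hφB : ∀ n, ∀ y ∉ B, φ n y = 0 := fun n y hy => by simp [hφ, hhB y hy]
  have hφlim : ∀ y, Filter.Tendsto (fun n => φ n y) Filter.atTop (nhds (h y)) := fun y =>
    (tendsto_nat_floor_mul_div_atTop (h0 y)).comp
      (Filter.tendsto_atTop_add_const_right _ 1 tendsto_natCast_atTop_atTop)
  have heq : ∀ n, ∫ ω, Real.exp (-∑' i, φ n (z i ω)) ∂P =
      Real.exp (-(lam * ∫ y, (1 - Real.exp (-φ n y)))) := fun n =>
    hz.integral_exp_neg_tsum_of_nat hlam hB hB1 (ψ := fun y => ⌊h y * (n + 1 : ℝ)⌋₊)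
      (hh.mul_const _).nat_floor (N := ⌊M * (n + 1 : ℝ)⌋₊ + 1)
      (fun y => Nat.lt_succ_of_le (Nat.floor_le_floor
        (mul_le_mul_of_nonneg_right (hM y) (by positivity))))
      (fun y hy => by simp [hhB y hy]) (c := fun k => (k : ℝ) / (n + 1 : ℝ)) (by simp)
  have hL : Filter.Tendsto (fun n => ∫ ω, Real.exp (-∑' i, φ n (z i ω)) ∂P) Filter.atTop
      (nhds (∫ ω, Real.exp (-∑' i, h (z i ω)) ∂P)) := by
    refine tendsto_integral_of_dominated_convergence (fun _ => 1) (fun n => ?_)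
      (integrable_const _) (fun n => ?_) ?_
    · exact (Real.measurable_exp.comp (Measurable.tsum
        fun i => (hφm n).comp (hz.measurable i)).neg).aestronglyMeasurable
    · filter_upwards with ω
      rw [Real.norm_eq_abs, Real.abs_exp, Real.exp_le_one_iff, neg_nonpos]
      exact tsum_nonneg fun i => hφ0 n _
    · filter_upwards [hz.ae_count_ne_top hB hB1] with ω hω
      have hT : {i | z i ω ∈ B}.Finite := Set.encard_ne_top_iff.1 hω
      have hsum : ∀ f : ℝ → ℝ, (∀ y ∉ B, f y = 0) →
          ∑' i, f (z i ω) = ∑ i ∈ hT.toFinset, f (z i ω) := fun f hf =>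
        tsum_eq_sum fun i hi => hf _ (by simpa using hi)
      simp_rw [hsum _ (hφB _), hsum h hhB]
      exact (Real.continuous_exp.tendsto _).comp
        (tendsto_finsetSum _ fun i _ => hφlim (z i ω)).neg
  have hR : Filter.Tendsto (fun n => ∫ y, (1 - Real.exp (-φ n y))) Filter.atTop
      (nhds (∫ y, (1 - Real.exp (-h y)))) := by
    refine tendsto_integral_of_dominated_convergence (B.indicator fun _ => (1 : ℝ)) (fun n => ?_)
      ((integrable_indicator_iff hB).2 (integrableOn_const hB1)) (fun n => ?_) ?_
    · exact (measurable_const.sub (Real.measurable_exp.comp (hφm n).neg)).aestronglyMeasurable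
    · filter_upwards with y
      by_cases hy : y ∈ B
      · rw [indicator_of_mem hy, Real.norm_eq_abs, abs_of_nonneg]
        · linarith [Real.exp_pos (-φ n y)]
        · have : Real.exp (-φ n y) ≤ 1 := Real.exp_le_one_iff.2 (neg_nonpos.2 (hφ0 n y))
          linarith
      · simp [hφB n y hy, hy]
    · filter_upwards with y
      exact ((Real.continuous_exp.tendsto _).comp (hφlim y).neg).const_sub 1
  refine tendsto_nhds_unique hL ?_
  simp_rw [heq]
  exact (Real.continuous_exp.tendsto _).comp (hR.const_mul lam).neg

end IsPoissonProcess

end Laplace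

end

end Platoon

namespace Platoon

noncomputable section

/-! ### Iterated integrals of independent random elements -/

section Independence

variable {Ω α β : Type*} [MeasurableSpace Ω] [MeasurableSpace α] [MeasurableSpace β]
  {P : Measure Ω} [IsProbabilityMeasure P] {X : Ω → α} {Y : Ω → β}

/-- Independence makes the joint law a product, so Tonelli applies. This replaces conditioning: one
random element is frozen while the other is averaged. -/
theorem lintegral_of_indepFun (hX : Measurable X) (hY : Measurable Y) (h : IndepFun X Y P)
    {F : α → β → ℝ≥0∞} (hF : Measurable (Function.uncurry F)) :
    ∫⁻ ω, F (X ω) (Y ω) ∂P = ∫⁻ ω, ∫⁻ ω', F (X ω) (Y ω') ∂P ∂P := by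
  have h1 := (indepFun_iff_map_prod_eq_prod_map_map hX.aemeasurable hY.aemeasurable).1 h
  calc ∫⁻ ω, F (X ω) (Y ω) ∂P
      = ∫⁻ p, Function.uncurry F p ∂(P.map fun ω => (X ω, Y ω)) :=
        (lintegral_map hF (hX.prodMk hY)).symm
    _ = ∫⁻ a, ∫⁻ b, F a b ∂(P.map Y) ∂(P.map X) := by
        rw [h1, lintegral_prod _ hF.aemeasurable]
        rfl
    _ = ∫⁻ ω, ∫⁻ b, F (X ω) b ∂(P.map Y) ∂P := by
        exact lintegral_map (f := fun a => ∫⁻ b, F a b ∂(P.map Y)) hF.lintegral_prod_right' hX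
    _ = _ := by
        refine lintegral_congr fun ω => ?_
        exact lintegral_map (f := F (X ω)) (hF.comp measurable_prodMk_left) hY

theorem measure_of_indepFun (hX : Measurable X) (hY : Measurable Y) (h : IndepFun X Y P)
    {S : Set (α × β)} (hS : MeasurableSet S) :
    P {ω | (X ω, Y ω) ∈ S} = ∫⁻ ω, P {ω' | (X ω, Y ω') ∈ S} ∂P := by
  have h1 := lintegral_of_indepFun hX hY h (F := fun a b => S.indicator 1 (a, b))
    (measurable_one.indicator hS)
  have h2 : MeasurableSet {ω | (X ω, Y ω) ∈ S} := (hX.prodMk hY) hS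
  rw [← lintegral_indicator_one h2]
  refine h1.trans (lintegral_congr fun ω => ?_)
  have h3 : MeasurableSet {ω' | (X ω, Y ω') ∈ S} := (measurable_const.prodMk hY) hS
  rw [← lintegral_indicator_one h3]
  rfl

theorem integral_of_indepFun (hX : Measurable X) (hY : Measurable Y) (h : IndepFun X Y P)
    {F : α → β → ℝ} (hF : Measurable (Function.uncurry F)) {C : ℝ} (hC : ∀ a b, |F a b| ≤ C) :
    ∫ ω, F (X ω) (Y ω) ∂P = ∫ ω, ∫ ω', F (X ω) (Y ω') ∂P ∂P := by
  have h1 := (indepFun_iff_map_prod_eq_prod_map_map hX.aemeasurable hY.aemeasurable).1 h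
  have : IsProbabilityMeasure (P.map X) := Measure.isProbabilityMeasure_map hX.aemeasurable
  have : IsProbabilityMeasure (P.map Y) := Measure.isProbabilityMeasure_map hY.aemeasurable
  calc ∫ ω, F (X ω) (Y ω) ∂P
      = ∫ p, Function.uncurry F p ∂(P.map fun ω => (X ω, Y ω)) :=
        (integral_map (hX.prodMk hY).aemeasurable hF.aestronglyMeasurable).symm
    _ = ∫ a, ∫ b, F a b ∂(P.map Y) ∂(P.map X) := by
        rw [h1, integral_prod]
        · rfl
        · exact Integrable.of_bound hF.aestronglyMeasurable C
            (Filter.Eventually.of_forall fun p => hC p.1 p.2)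
    _ = ∫ ω, ∫ b, F (X ω) b ∂(P.map Y) ∂P := by
        rw [integral_map hX.aemeasurable]
        exact (hF.stronglyMeasurable.integral_prod_right').aestronglyMeasurable
    _ = _ := by
        refine integral_congr_ae (Filter.Eventually.of_forall fun ω => ?_)
        exact integral_map hY.aemeasurable (hF.comp measurable_prodMk_left).aestronglyMeasurable

/-- With X frozen, the event says that Y hits a fixed value, and Y has no atoms. -/
theorem measure_eq_eq_zero_of_indepFun {X Y : Ω → ℝ} (hX : Measurable X) (hY : Measurable Y)
    (h : IndepFun X Y P) (h0 : ∀ d, P {ω | Y ω = d} = 0) : P {ω | X ω = Y ω} = 0 := by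
  have h1 := measure_of_indepFun hX hY h (S := {p : ℝ × ℝ | p.2 = p.1})
    (measurableSet_eq_fun measurable_snd measurable_fst)
  have h2 : {ω | X ω = Y ω} = {ω | (X ω, Y ω) ∈ {p : ℝ × ℝ | p.2 = p.1}} := by
    ext ω
    exact eq_comm
  rw [h2, h1]
  refine (lintegral_congr fun ω => h0 (X ω)).trans lintegral_zero

/-- The generating function of an almost surely finite counting variable. -/
theorem hasSum_measure_mul_pow {N : Ω → ℕ∞} (hN : Measurable N) (hN1 : ∀ᵐ ω ∂P, N ω ≠ ⊤)
    {s : ℝ} (hs : |s| ≤ 1) :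
    HasSum (fun k : ℕ => (P {ω | N ω = k}).toReal * s ^ k) (∫ ω, s ^ (N ω).toNat ∂P) := by
  have hm : Measurable fun ω => (N ω).toNat := Measurable.of_discrete.comp hN
  have : IsProbabilityMeasure (P.map fun ω => (N ω).toNat) :=
    Measure.isProbabilityMeasure_map hm.aemeasurable
  have hbd : ∀ n : ℕ, |s ^ n| ≤ 1 := fun n => by
    rw [abs_pow]
    exact pow_le_one₀ (abs_nonneg s) hs
  have hk : ∀ k : ℕ, P {ω | N ω = k} = (P.map fun ω => (N ω).toNat) {k} := by
    intro k
    rw [Measure.map_apply hm (measurableSet_singleton _)]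
    refine measure_congr ?_
    filter_upwards [hN1] with ω hω
    refine propext ?_
    change N ω = k ↔ (N ω).toNat = k
    constructor
    · intro h
      rw [h]
      rfl
    · rintro rfl
      exact (ENat.natCast_toNat hω).symm
  simp_rw [hk]
  rw [← integral_map (f := fun n : ℕ => s ^ n) hm.aemeasurable
    Measurable.of_discrete.aestronglyMeasurable]
  have hint : Integrable (fun n : ℕ => s ^ n) (P.map fun ω => (N ω).toNat) :=
    Integrable.of_bound Measurable.of_discrete.aestronglyMeasurable 1
      (Filter.Eventually.of_forall hbd)
  rw [integral_countable hint]
  refine Summable.hasSum ?_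
  have h1 : ∑' k, (P.map fun ω => (N ω).toNat) {k} ≠ ∞ := by
    have := lintegral_countable' (μ := P.map fun ω => (N ω).toNat) (fun _ => (1 : ℝ≥0∞))
    simp only [one_mul, lintegral_one, measure_univ] at this
    rw [← this]
    exact ENNReal.one_ne_top
  refine Summable.of_norm_bounded (ENNReal.summable_toReal h1) fun k => ?_
  rw [norm_mul, Real.norm_of_nonneg ENNReal.toReal_nonneg]
  exact mul_le_of_le_one_right ENNReal.toReal_nonneg (hbd k)

end Independence

/-! ### The number of daughters in a ball -/

/-- The number of daughters in a ball, counted with multiplicity, for given parents `x`, numbers of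
daughters `k` and displacements `u`. -/
def daughterCount (c r : ℝ) (x : ℕ → ℝ) (k : ℕ → ℕ) (u : ℕ → ℕ → ℝ) : ℕ∞ :=
  {p : ℕ × ℕ | p.2 < k p.1 ∧ x p.1 + u p.1 p.2 ∈ Metric.closedBall c r}.encard

/-- The center and radius are kept as variables because the ball will be a random Voronoi cell. -/
theorem measurable_daughterCount :
    Measurable fun q : (ℝ × ℝ) × (ℕ → ℝ) × (ℕ → ℕ) × (ℕ → ℕ → ℝ) =>
      daughterCount q.1.1 q.1.2 q.2.1 q.2.2.1 q.2.2.2 := by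
  refine measurable_encard_setOf (S := fun p : ℕ × ℕ =>
    {q : (ℝ × ℝ) × (ℕ → ℝ) × (ℕ → ℕ) × (ℕ → ℕ → ℝ) |
      p.2 < q.2.2.1 p.1 ∧ q.2.1 p.1 + q.2.2.2 p.1 p.2 ∈ Metric.closedBall q.1.1 q.1.2}) fun p => ?_
  have hk : Measurable fun q : (ℝ × ℝ) × (ℕ → ℝ) × (ℕ → ℕ) × (ℕ → ℕ → ℝ) => q.2.2.1 p.1 := by
    fun_prop
  have hd : Measurable fun q : (ℝ × ℝ) × (ℕ → ℝ) × (ℕ → ℕ) × (ℕ → ℕ → ℝ) =>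
      dist (q.2.1 p.1 + q.2.2.2 p.1 p.2) q.1.1 := by
    fun_prop
  exact (measurableSet_lt measurable_const hk).inter
    (measurableSet_le hd measurable_fst.snd)

theorem overlap_nonneg {r a : ℝ} (hr : 0 ≤ r) (ha : 0 ≤ a) (d : ℝ) : 0 ≤ overlap r a d := by
  unfold overlap
  split_ifs with h1 h2
  · exact mul_nonneg two_pos.le (le_min hr ha)
  · linarith
  · exact le_rfl

theorem overlap_le {r a : ℝ} (d : ℝ) (ha : 0 ≤ a) : overlap r a d ≤ 2 * a := by
  unfold overlap
  split_ifs with h1 h2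
  · linarith [min_le_right r a]
  · linarith [neg_abs_le (r - a), le_abs_self (r - a)]
  · linarith

theorem overlap_eq_zero {r a d : ℝ} (hr : 0 ≤ r) (ha : 0 ≤ a) (hd : r + a ≤ d) :
    overlap r a d = 0 := by
  unfold overlap
  split_ifs with h1 h2
  · rcases abs_cases (r - a) with h | h
    · have : a = 0 := by linarith
      rw [this, min_eq_right hr, mul_zero]
    · have : r = 0 := by linarith
      rw [this, min_eq_left ha, mul_zero]
  · linarith
  · rfl

theorem measurable_overlap (r a : ℝ) : Measurable (overlap r a) :=
  Measurable.ite measurableSet_Iic measurable_const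
    (Measurable.ite measurableSet_Iio (by fun_prop) measurable_const)

/-- Here y is a parent: the second interval consists of the displacements that carry a daughter of y
into the ball around c. -/
theorem volume_Icc_inter_Icc {r a y c : ℝ} (_hr : 0 < r) (_ha : 0 < a) :
    volume (Icc (-a) a ∩ Icc (c - r - y) (c + r - y)) =
      ENNReal.ofReal (overlap r a |y - c|) := by
  rw [Icc_inter_Icc, Real.volume_Icc]
  unfold overlap
  rcases abs_cases (y - c) with ⟨h1, h1'⟩ | ⟨h1, h1'⟩ <;>
  rcases abs_cases (r - a) with ⟨h2, h2'⟩ | ⟨h2, h2'⟩ <;>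
  rw [h1, h2] <;>
  rcases le_total (-a) (c - r - y) with h3 | h3 <;>
  rcases le_total a (c + r - y) with h4 | h4 <;>
  simp only [max_eq_left, max_eq_right, min_eq_left, min_eq_right, h3, h4] <;>
  split_ifs with h5 h6 <;>
  first
  | (rw [min_eq_left (by linarith)]; congr 1; linarith)
  | (rw [min_eq_right (by linarith)]; congr 1; linarith)
  | (congr 1; linarith)
  | (rw [ENNReal.ofReal_zero, ENNReal.ofReal_of_nonpos (by linarith)])

end

end Platoon

namespace Platoon

noncomputable section

/-! ### The number of points of a Matérn cluster process in a ball -/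

/-- The function with value `s` on the ball of radius `r` around `c`, and `1` elsewhere. -/
def ballWeight (c r s t : ℝ) : ℝ := 1 + (Metric.closedBall c r).indicator (fun _ => s - 1) t

theorem ballWeight_of_mem {c r s t : ℝ} (h : t ∈ Metric.closedBall c r) :
    ballWeight c r s t = s := by
  rw [ballWeight, indicator_of_mem h]
  ring

theorem ballWeight_of_notMem {c r s t : ℝ} (h : t ∉ Metric.closedBall c r) :
    ballWeight c r s t = 1 := by
  rw [ballWeight, indicator_of_notMem h, add_zero]

theorem measurable_ballWeight (c r s : ℝ) : Measurable (ballWeight c r s) :=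
  measurable_const.add (measurable_const.indicator Metric.isClosed_closedBall.measurableSet)

/-- Weighting daughters by s inside the ball and by 1 outside turns s ^ count into a product over
individual daughters. Parents outside the finite set T contribute nothing. -/
theorem daughterCount_ne_top_and_pow_eq_prod {c r : ℝ} {y : ℕ → ℝ} {k : ℕ → ℕ} {u : ℕ → ℕ → ℝ}
    {T : Finset ℕ} (hT : ∀ i ∉ T, ∀ j, y i + u i j ∉ Metric.closedBall c r) (s : ℝ) :
    daughterCount c r y k u ≠ ⊤ ∧ s ^ (daughterCount c r y k u).toNat =
      ∏ i ∈ T, ∏ j ∈ Finset.range (k i),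
        ballWeight c r s (y i + u i j) := by
  classical
  set D : Finset (ℕ × ℕ) :=
    (T.sigma fun i => Finset.range (k i)).map (Equiv.sigmaEquivProd ℕ ℕ).toEmbedding with hD
  have hset : {p : ℕ × ℕ | p.2 < k p.1 ∧ y p.1 + u p.1 p.2 ∈ Metric.closedBall c r} =
      (D.filter fun p => y p.1 + u p.1 p.2 ∈ Metric.closedBall c r : Finset (ℕ × ℕ)) := by
    ext p
    simp only [mem_ofPred_eq, Finset.coe_filter, hD, Finset.mem_map_equiv, Finset.mem_sigma,
      Equiv.sigmaEquivProd_symm_apply, Finset.mem_range]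
    constructor
    · rintro ⟨h1, h2⟩
      refine ⟨⟨?_, h1⟩, h2⟩
      by_contra hp
      exact hT _ hp _ h2
    · rintro ⟨⟨_, h1⟩, h2⟩
      exact ⟨h1, h2⟩
  rw [daughterCount, hset, Set.encard_coe_eq_coe_finsetCard]
  refine ⟨ENat.natCast_ne_top _, ?_⟩
  rw [ENat.toNat_natCast, ← Finset.prod_const, Finset.prod_filter, hD, Finset.prod_map,
    Finset.prod_sigma]
  refine Finset.prod_congr rfl fun i _ => Finset.prod_congr rfl fun j _ => ?_
  by_cases h : y i + u i j ∈ Metric.closedBall c r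
  · rw [ballWeight_of_mem h, if_pos (by exact h)]
  · rw [ballWeight_of_notMem h, if_neg (by exact h)]

/-- The probability that a daughter of a parent at `y` lies in the ball of radius `r` around `c`. -/
def hitProb (a c r y : ℝ) : ℝ := overlap r a |y - c| / (2 * a)

theorem measurable_hitProb (a c r : ℝ) : Measurable (hitProb a c r) :=
  ((measurable_overlap r a).comp (by fun_prop : Measurable fun y : ℝ => |y - c|)).div_const _

theorem hitProb_nonneg {a c r : ℝ} (ha : 0 ≤ a) (hr : 0 ≤ r) (y : ℝ) : 0 ≤ hitProb a c r y :=
  div_nonneg (overlap_nonneg hr ha _) (by positivity)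

theorem hitProb_le_one {a c r : ℝ} (ha : 0 < a) (y : ℝ) : hitProb a c r y ≤ 1 :=
  (div_le_one (by positivity)).2 (overlap_le _ ha.le)

theorem hitProb_eq_zero {a c r y : ℝ} (ha : 0 ≤ a) (hr : 0 ≤ r)
    (hy : y ∉ Metric.closedBall c (r + a)) : hitProb a c r y = 0 := by
  rw [Metric.mem_closedBall, Real.dist_eq, not_le] at hy
  rw [hitProb, overlap_eq_zero hr ha hy.le, zero_div]

namespace IsMaternCluster

variable {Ω : Type*} [MeasurableSpace Ω] {P : Measure Ω}
  {x : ℕ → Ω → ℝ} {K : ℕ → Ω → ℕ} {U : ℕ → ℕ → Ω → ℝ} {lamP m a : ℝ}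

theorem measurable_x_seq (hV : IsMaternCluster P x K U lamP m a) :
    Measurable fun ω i => x i ω := measurable_pi_iff.2 hV.parents.measurable

theorem measurable_K_seq (hV : IsMaternCluster P x K U lamP m a) :
    Measurable fun ω i => K i ω := measurable_pi_iff.2 hV.measurable_K

theorem measurable_U_seq (hV : IsMaternCluster P x K U lamP m a) :
    Measurable fun ω i j => U i j ω :=
  measurable_pi_iff.2 fun i => measurable_pi_iff.2 fun j => hV.measurable_U i j

theorem measure_hit (hV : IsMaternCluster P x K U lamP m a) (ha : 0 < a) {r : ℝ} (hr : 0 < r)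
    (c y : ℝ) (i j : ℕ) :
    P.real {ω | y + U i j ω ∈ Metric.closedBall c r} = hitProb a c r y := by
  have hv : volume (Icc (-a) a) = ENNReal.ofReal (2 * a) := by
    rw [Real.volume_Icc]
    congr 1
    ring
  have hv0 : volume (Icc (-a) a) ≠ 0 := by
    rw [hv]
    simpa using ha
  have h := (hV.law_U i j).measure_preimage hv0 (by rw [hv]; exact ENNReal.ofReal_ne_top)
    (A := Icc (c - r - y) (c + r - y)) measurableSet_Icc
  rw [volume_Icc_inter_Icc hr ha, hv] at h
  have hset : {ω | y + U i j ω ∈ Metric.closedBall c r} =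
      U i j ⁻¹' Icc (c - r - y) (c + r - y) := by
    ext ω
    rw [mem_ofPred_eq, Real.closedBall_eq_Icc, mem_preimage, mem_Icc, mem_Icc]
    constructor <;> rintro ⟨h1, h2⟩ <;> constructor <;> linarith
  rw [Measure.real, hset, h, ENNReal.toReal_div, ENNReal.toReal_ofReal (overlap_nonneg hr.le ha.le _),
    ENNReal.toReal_ofReal (by positivity), hitProb]

theorem integral_prod_pow (hV : IsMaternCluster P x K U lamP m a) (hm : 0 ≤ m) (T : Finset ℕ)
    (b : ℕ → ℝ) :
    ∫ ω, ∏ i ∈ T, b i ^ K i ω ∂P = Real.exp (∑ i ∈ T, m * (b i - 1)) := by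
  have h1 := (hV.indep_K.precomp (g := fun i : T => (i : ℕ))
    Subtype.val_injective).integral_fun_prod_comp
    (f := fun i : T => fun n : ℕ => b i ^ n) (fun i => (hV.measurable_K i).aemeasurable)
    (fun i => Measurable.of_discrete.aestronglyMeasurable)
  have h2 : ∀ F : ℕ → ℝ, ∏ i : T, F i = ∏ i ∈ T, F i := fun F => Finset.prod_coe_sort T F
  have h3 : ∀ i, ∫ ω, b i ^ K i ω ∂P = Real.exp (m * (b i - 1)) := by
    intro i
    rw [← integral_map (f := fun n : ℕ => b i ^ n) (hV.measurable_K i).aemeasurable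
      Measurable.of_discrete.aestronglyMeasurable, hV.law_K i, integral_poissonMeasure_pow,
      Real.coe_toNNReal _ hm]
  calc ∫ ω, ∏ i ∈ T, b i ^ K i ω ∂P = ∫ ω, ∏ i : T, b i ^ K i ω ∂P :=
        integral_congr_ae (Filter.Eventually.of_forall fun ω => (h2 fun i => b i ^ K i ω).symm)
    _ = ∏ i : T, ∫ ω, b i ^ K i ω ∂P := h1
    _ = ∏ i ∈ T, ∫ ω, b i ^ K i ω ∂P := h2 fun i => ∫ ω, b i ^ K i ω ∂P
    _ = _ := by
        simp_rw [h3]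
        rw [Real.exp_sum]

variable [IsProbabilityMeasure P]

theorem integral_ballWeight (hV : IsMaternCluster P x K U lamP m a) (ha : 0 < a) {r : ℝ}
    (hr : 0 < r) (c y s : ℝ) (i j : ℕ) :
    ∫ ω, ballWeight c r s (y + U i j ω) ∂P =
      1 + hitProb a c r y * (s - 1) := by
  have hE : MeasurableSet {ω | y + U i j ω ∈ Metric.closedBall c r} :=
    ((hV.measurable_U i j).const_add y) Metric.isClosed_closedBall.measurableSet
  have h1 : ∀ ω, ballWeight c r s (y + U i j ω) =
      1 + {ω | y + U i j ω ∈ Metric.closedBall c r}.indicator (fun _ => s - 1) ω := fun ω => rfl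
  simp_rw [h1]
  rw [integral_add (integrable_const _) ((integrable_const _).indicator hE),
    integral_indicator_const _ hE, hV.measure_hit ha hr]
  simp

theorem integral_prod_ballWeight (hV : IsMaternCluster P x K U lamP m a) (ha : 0 < a) {r : ℝ}
    (hr : 0 < r) (c s : ℝ) (y : ℕ → ℝ) (T : Finset ℕ) (k : ℕ → ℕ) :
    ∫ ω, ∏ i ∈ T, ∏ j ∈ Finset.range (k i),
        ballWeight c r s (y i + U i j ω) ∂P =
      ∏ i ∈ T, (1 + hitProb a c r (y i) * (s - 1)) ^ k i := by
  set w : ℝ → ℝ := ballWeight c r s with hw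
  have hwm : Measurable w := measurable_ballWeight c r s
  have hinj : Function.Injective
      (fun p : (Σ i : T, Fin (k i)) => (((p.1 : ℕ), (p.2 : ℕ)) : ℕ × ℕ)) := by
    rintro ⟨⟨i, hi⟩, j⟩ ⟨⟨i', hi'⟩, j'⟩ h
    simp only [Prod.mk.injEq] at h
    obtain ⟨rfl, h2⟩ := h
    rw [Fin.ext h2]
  have h1 := (hV.indep_U.precomp hinj).integral_fun_prod_comp
    (f := fun p : (Σ i : T, Fin (k i)) => fun t => w (y p.1 + t))
    (fun p => (hV.measurable_U _ _).aemeasurable)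
    (fun p => (hwm.comp (measurable_const_add _)).aestronglyMeasurable)
  simp only [Fintype.prod_sigma] at h1
  have h2 : ∀ F : ℕ → ℕ → ℝ, ∏ i : T, ∏ j : Fin (k i), F i j =
      ∏ i ∈ T, ∏ j ∈ Finset.range (k i), F i j := by
    intro F
    rw [← Finset.prod_coe_sort T]
    exact Finset.prod_congr rfl fun i _ => Fin.prod_univ_eq_prod_range (F i) (k i)
  calc ∫ ω, ∏ i ∈ T, ∏ j ∈ Finset.range (k i), w (y i + U i j ω) ∂P
      = ∫ ω, ∏ i : T, ∏ j : Fin (k i), w (y i + U i j ω) ∂P :=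
        integral_congr_ae (Filter.Eventually.of_forall fun ω =>
          (h2 fun i j => w (y i + U i j ω)).symm)
    _ = ∏ i : T, ∏ j : Fin (k i), ∫ ω, w (y i + U i j ω) ∂P := h1
    _ = ∏ i ∈ T, ∏ j ∈ Finset.range (k i), ∫ ω, w (y i + U i j ω) ∂P :=
        h2 fun i j => ∫ ω, w (y i + U i j ω) ∂P
    _ = _ := by
        simp_rw [hw, hV.integral_ballWeight ha hr]
        simp

theorem ae_notMem_closedBall (hV : IsMaternCluster P x K U lamP m a) (ha : 0 < a) {r : ℝ}
    (hr : 0 < r) {c : ℝ} {y : ℕ → ℝ} {T : Finset ℕ} (hT : ∀ i ∉ T, hitProb a c r (y i) = 0) :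
    ∀ᵐ ω ∂P, ∀ i ∉ T, ∀ j, y i + U i j ω ∉ Metric.closedBall c r := by
  rw [ae_all_iff]
  intro i
  by_cases hi : i ∈ T
  · exact Filter.Eventually.of_forall fun ω h => absurd hi h
  · have : ∀ᵐ ω ∂P, ∀ j, y i + U i j ω ∉ Metric.closedBall c r := by
      rw [ae_all_iff]
      intro j
      have h := hV.measure_hit ha hr c (y i) i j
      rw [hT i hi, measureReal_eq_zero_iff] at h
      rw [ae_iff]
      simpa using h
    filter_upwards [this] with ω hω _ using hω

/-- For fixed parents, the number of daughters in a ball is almost surely finite. -/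
theorem ae_daughterCount_ne_top (hV : IsMaternCluster P x K U lamP m a) (ha : 0 < a) {r : ℝ}
    (hr : 0 < r) {c : ℝ} {y : ℕ → ℝ} {T : Finset ℕ} (hT : ∀ i ∉ T, hitProb a c r (y i) = 0) :
    ∀ᵐ ω ∂P, daughterCount c r y (fun i => K i ω) (fun i j => U i j ω) ≠ ⊤ := by
  filter_upwards [hV.ae_notMem_closedBall ha hr hT] with ω hω
  exact (daughterCount_ne_top_and_pow_eq_prod hω 0).1

/-- For fixed parents, the number of daughters in a ball has a Poisson generating function. -/
theorem integral_pow_daughterCount (hV : IsMaternCluster P x K U lamP m a) (ha : 0 < a)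
    (hm : 0 ≤ m) {r : ℝ} (hr : 0 < r) {c : ℝ} {y : ℕ → ℝ} {T : Finset ℕ}
    (hT : ∀ i ∉ T, hitProb a c r (y i) = 0) {s : ℝ} (hs : |s| ≤ 1) :
    ∫ ω, s ^ (daughterCount c r y (fun i => K i ω) (fun i j => U i j ω)).toNat ∂P =
      Real.exp (-∑' i, m * (1 - s) * hitProb a c r (y i)) := by
  have hF : Measurable (Function.uncurry fun (k : ℕ → ℕ) (u : ℕ → ℕ → ℝ) =>
      s ^ (daughterCount c r y k u).toNat) := by
    have h1 : Measurable fun p : (ℕ → ℕ) × (ℕ → ℕ → ℝ) => daughterCount c r y p.1 p.2 :=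
      measurable_daughterCount.comp (f := fun p : (ℕ → ℕ) × (ℕ → ℕ → ℝ) => ((c, r), y, p))
        (by fun_prop)
    exact (Measurable.of_discrete (f := fun n : ℕ∞ => s ^ n.toNat)).comp h1
  rw [integral_of_indepFun hV.measurable_K_seq hV.measurable_U_seq hV.indep_K_U hF (C := 1)
    fun k u => by rw [abs_pow]; exact pow_le_one₀ (abs_nonneg s) hs]
  -- With the numbers of daughters frozen, averaging the displacements gives each parent the factor
  -- (1 + p (s - 1)) ^ K, where p is its hit probability; the Poisson law of K then gives exp(m p (s
  -- - 1)).
  have h1 : ∀ ω, ∫ ω', s ^ (daughterCount c r y (fun i => K i ω) (fun i j => U i j ω')).toNat ∂P =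
      ∏ i ∈ T, (1 + hitProb a c r (y i) * (s - 1)) ^ K i ω := by
    intro ω
    rw [← hV.integral_prod_ballWeight ha hr c s y T fun i => K i ω]
    refine integral_congr_ae ?_
    filter_upwards [hV.ae_notMem_closedBall ha hr hT] with ω' hω'
    exact (daughterCount_ne_top_and_pow_eq_prod hω' s).2
  simp_rw [h1]
  rw [hV.integral_prod_pow hm, tsum_eq_sum (s := T) fun i hi => by rw [hT i hi, mul_zero],
    ← Finset.sum_neg_distrib]
  congr 1
  refine Finset.sum_congr rfl fun i _ => ?_
  ring

end IsMaternCluster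

end

end Platoon

namespace Platoon

noncomputable section

/-! ### The generating function of the number of vehicles in a ball -/

/-- The integrand depends only on |y - c| and vanishes beyond r + a, so a shift and a fold reduce it
to twice an integral over [0, r + a]. This is where the center c disappears. -/
theorem g_eq_integral {lamP m a s r c : ℝ} (hm : 0 ≤ m) (ha : 0 < a) (hr : 0 < r) (hs : s ≤ 1) :
    -(lamP * ∫ y, (1 - Real.exp (-(m * (1 - s) * hitProb a c r y)))) = g lamP m a s r := by
  set f : ℝ → ℝ := fun d => 1 - Real.exp (m * (overlap r a d / (2 * a)) * (s - 1)) with hf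
  have hra : 0 ≤ r + a := by positivity
  have h1 : ∫ y, (1 - Real.exp (-(m * (1 - s) * hitProb a c r y))) = ∫ y, f |y| := by
    rw [← integral_sub_right_eq_self (fun y => f |y|) c]
    refine integral_congr_ae (Filter.Eventually.of_forall fun y => ?_)
    simp only [hf, hitProb]
    congr 2
    ring
  have h2 : ∫ y in Ioi 0, f y = ∫ y in Ioc 0 (r + a), f y := by
    refine setIntegral_eq_of_subset_of_forall_sdiff_eq_zero measurableSet_Ioi Ioc_subset_Ioi_self
      fun y hy => ?_
    have hy' : r + a ≤ y := by
      by_contra! h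
      exact hy.2 ⟨hy.1, h.le⟩
    simp [hf, overlap_eq_zero hr.le ha.le hy']
  have h3 : ∀ d, Real.exp (m * (overlap r a d / (2 * a)) * (s - 1)) ≤ 1 := fun d => by
    rw [Real.exp_le_one_iff]
    exact mul_nonpos_of_nonneg_of_nonpos
      (mul_nonneg hm (div_nonneg (overlap_nonneg hr.le ha.le d) (by positivity))) (by linarith)
  have h4 : IntervalIntegrable (fun d => Real.exp (m * (overlap r a d / (2 * a)) * (s - 1)))
      volume 0 (r + a) := by
    rw [intervalIntegrable_iff_integrableOn_Ioc_of_le hra]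
    refine IntegrableOn.of_bound measure_Ioc_lt_top ?_ 1 (Filter.Eventually.of_forall fun d => ?_)
    · exact (Real.measurable_exp.comp
        ((((measurable_overlap r a).div_const _).const_mul m).mul_const _)).aestronglyMeasurable
    · rw [Real.norm_eq_abs, Real.abs_exp]
      exact h3 d
  rw [h1, integral_comp_abs, h2, ← intervalIntegral.integral_of_le hra,
    intervalIntegral.integral_sub intervalIntegrable_const h4, g]
  simp
  ring

namespace IsMaternCluster

variable {Ω : Type*} [MeasurableSpace Ω] {P : Measure Ω}
  {x : ℕ → Ω → ℝ} {K : ℕ → Ω → ℕ} {U : ℕ → ℕ → Ω → ℝ} {lamP m a : ℝ}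

/-- The number of daughters in a ball, counted with multiplicity. -/
def ballCount (x : ℕ → Ω → ℝ) (K : ℕ → Ω → ℕ) (U : ℕ → ℕ → Ω → ℝ) (c r : ℝ) (ω : Ω) : ℕ∞ :=
  daughterCount c r (fun i => x i ω) (fun i => K i ω) (fun i j => U i j ω)

theorem measurable_ballCount (hV : IsMaternCluster P x K U lamP m a) :
    Measurable fun p : (ℝ × ℝ) × Ω => ballCount x K U p.1.1 p.1.2 p.2 := by
  refine measurable_daughterCount.comp (f := fun p : (ℝ × ℝ) × Ω => (p.1,
    (fun i => x i p.2), (fun i => K i p.2), (fun i j => U i j p.2))) ?_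
  have h1 : Measurable fun p : (ℝ × ℝ) × Ω => (fun i => x i p.2) :=
    hV.measurable_x_seq.comp measurable_snd
  have h2 : Measurable fun p : (ℝ × ℝ) × Ω => (fun i => K i p.2) :=
    hV.measurable_K_seq.comp measurable_snd
  have h3 : Measurable fun p : (ℝ × ℝ) × Ω => (fun i j => U i j p.2) :=
    hV.measurable_U_seq.comp measurable_snd
  exact measurable_fst.prodMk (h1.prodMk (h2.prodMk h3))

theorem measurable_ballCount_right (hV : IsMaternCluster P x K U lamP m a) (c r : ℝ) :
    Measurable (ballCount x K U c r) :=
  hV.measurable_ballCount.comp (f := fun ω => ((c, r), ω)) (by fun_prop)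

variable [IsProbabilityMeasure P]

theorem ae_exists_finset_hitProb_eq_zero (hV : IsMaternCluster P x K U lamP m a) (ha : 0 < a)
    {r : ℝ} (hr : 0 < r) (c : ℝ) :
    ∀ᵐ ω ∂P, ∃ T : Finset ℕ, ∀ i ∉ T, hitProb a c r (x i ω) = 0 := by
  have hB1 : volume (Metric.closedBall c (r + a)) ≠ ∞ := measure_closedBall_lt_top.ne
  filter_upwards [hV.parents.ae_count_ne_top Metric.isClosed_closedBall.measurableSet hB1] with ω hω
  have hT : {i | x i ω ∈ Metric.closedBall c (r + a)}.Finite := Set.encard_ne_top_iff.1 hω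
  refine ⟨hT.toFinset, fun i hi => hitProb_eq_zero ha.le hr.le ?_⟩
  simpa using hi

/-- Almost surely only finitely many parents are within r + a of c; freezing such a configuration
leaves finitely many relevant clusters. -/
theorem ae_ballCount_ne_top (hV : IsMaternCluster P x K U lamP m a) (ha : 0 < a)
    {r : ℝ} (hr : 0 < r) (c : ℝ) : ∀ᵐ ω ∂P, ballCount x K U c r ω ≠ ⊤ := by
  have hS : MeasurableSet {q : (ℕ → ℝ) × (ℕ → ℕ) × (ℕ → ℕ → ℝ) |
      daughterCount c r q.1 q.2.1 q.2.2 = ⊤} := by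
    have h := measurable_daughterCount.comp
      (f := fun q : (ℕ → ℝ) × (ℕ → ℕ) × (ℕ → ℕ → ℝ) => ((c, r), q)) (by fun_prop)
    exact h (measurableSet_singleton ⊤)
  have h1 := measure_of_indepFun hV.measurable_x_seq
    (hV.measurable_K_seq.prodMk hV.measurable_U_seq) hV.indep_parents hS
  have h2 : ∀ᵐ ω ∂P, P {ω' | ((fun i => x i ω), (fun i => K i ω'), (fun i j => U i j ω')) ∈
      {q : (ℕ → ℝ) × (ℕ → ℕ) × (ℕ → ℕ → ℝ) | daughterCount c r q.1 q.2.1 q.2.2 = ⊤}} = 0 := by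
    filter_upwards [hV.ae_exists_finset_hitProb_eq_zero ha hr c] with ω ⟨T, hT⟩
    have h3 := hV.ae_daughterCount_ne_top ha hr hT
    rw [ae_iff] at h3
    simpa using h3
  rw [lintegral_congr_ae h2, lintegral_zero] at h1
  rw [ae_iff]
  simpa [ballCount] using h1

/-- Given the parents, the PGF is exp(-∑ h(x i)) with h = m (1 - s) `hitProb`, so its mean is the
Laplace functional of the parent process at h. The condition s ≤ 1 makes h nonnegative. -/
theorem integral_pow_ballCount (hV : IsMaternCluster P x K U lamP m a) (hlamP : 0 ≤ lamP)
    (ha : 0 < a) (hm : 0 ≤ m) {r : ℝ} (hr : 0 < r) (c : ℝ) {s : ℝ} (hs : s ∈ Icc (-1 : ℝ) 1) :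
    ∫ ω, s ^ (ballCount x K U c r ω).toNat ∂P = Real.exp (g lamP m a s r) := by
  have hs' : |s| ≤ 1 := abs_le.2 hs
  have hF : Measurable (Function.uncurry fun (y : ℕ → ℝ) (q : (ℕ → ℕ) × (ℕ → ℕ → ℝ)) =>
      s ^ (daughterCount c r y q.1 q.2).toNat) :=
    (Measurable.of_discrete (f := fun n : ℕ∞ => s ^ n.toNat)).comp
      (measurable_daughterCount.comp
        (f := fun q : (ℕ → ℝ) × (ℕ → ℕ) × (ℕ → ℕ → ℝ) => ((c, r), q)) (by fun_prop))
  have h1 := integral_of_indepFun hV.measurable_x_seq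
    (hV.measurable_K_seq.prodMk hV.measurable_U_seq) hV.indep_parents hF (C := 1)
    fun y q => by rw [abs_pow]; exact pow_le_one₀ (abs_nonneg s) hs'
  have h2 : ∀ᵐ ω ∂P, ∫ ω', s ^ (daughterCount c r (fun i => x i ω) (fun i => K i ω')
      (fun i j => U i j ω')).toNat ∂P =
      Real.exp (-∑' i, m * (1 - s) * hitProb a c r (x i ω)) := by
    filter_upwards [hV.ae_exists_finset_hitProb_eq_zero ha hr c] with ω ⟨T, hT⟩
    exact hV.integral_pow_daughterCount ha hm hr hT hs'
  have hms : 0 ≤ m * (1 - s) := mul_nonneg hm (by linarith [hs.2])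
  have h3 := hV.parents.integral_exp_neg_tsum hlamP
    (B := Metric.closedBall c (r + a)) Metric.isClosed_closedBall.measurableSet
    measure_closedBall_lt_top.ne ((measurable_hitProb a c r).const_mul (m * (1 - s)))
    (fun y => mul_nonneg hms (hitProb_nonneg ha.le hr.le y))
    (M := m * (1 - s)) (fun y => mul_le_of_le_one_right hms (hitProb_le_one ha y))
    (fun y hy => by rw [hitProb_eq_zero ha.le hr.le hy, mul_zero])
  rw [← g_eq_integral (c := c) hm ha hr hs.2, ← h3, ← integral_congr_ae h2]
  exact h1

theorem hasSum_ballCount (hV : IsMaternCluster P x K U lamP m a) (hlamP : 0 ≤ lamP)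
    (ha : 0 < a) (hm : 0 ≤ m) {r : ℝ} (hr : 0 < r) (c : ℝ) {s : ℝ} (hs : s ∈ Icc (-1 : ℝ) 1) :
    HasSum (fun k : ℕ => (P {ω | ballCount x K U c r ω = k}).toReal * s ^ k)
      (Real.exp (g lamP m a s r)) := by
  rw [← hV.integral_pow_ballCount hlamP ha hm hr c hs]
  exact hasSum_measure_mul_pow (hV.measurable_ballCount_right c r) (hV.ae_ballCount_ne_top ha hr c)
    (abs_le.2 hs)

/-- The law of the number of daughters in a ball. -/
theorem measure_ballCount_eq (hV : IsMaternCluster P x K U lamP m a) (hlamP : 0 ≤ lamP)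
    (ha : 0 < a) (hm : 0 ≤ m) {r : ℝ} (hr : 0 < r) (c : ℝ) (k : ℕ) :
    (P {ω | ballCount x K U c r ω = k}).toReal = faaDiBruno lamP m a k r := by
  have h1 : ∀ s ∈ Icc (-1 : ℝ) 1, HasSum
      (fun k : ℕ => (P {ω | ballCount x K U c r ω = k}).toReal * s ^ k)
      (Real.exp (g lamP m a s r)) := fun s hs => hV.hasSum_ballCount hlamP ha hm hr c hs
  -- No differentiation under the integral is needed: exp(g) is the sum of a convergent power series
  -- and is positive, so its logarithm g is analytic.
  have h2 : AnalyticAt ℝ (fun s => g lamP m a s r) 0 := by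
    have := (hasFPowerSeriesAt_of_hasSum h1).analyticAt.log (Real.exp_pos _)
    simpa [Real.log_exp] using this
  rw [eq_iteratedDeriv_of_hasSum h1 k, iteratedDeriv_exp_comp_div_factorial h2, faaDiBruno]

/-- Almost surely, the daughter points are pairwise distinct. -/
theorem ae_injective (hV : IsMaternCluster P x K U lamP m a) :
    ∀ᵐ ω ∂P, Function.Injective fun p : ℕ × ℕ => x p.1 ω + U p.1 p.2 ω := by
  have h : ∀ᵐ ω ∂P, ∀ p q : ℕ × ℕ, p ≠ q → x p.1 ω + U p.1 p.2 ω ≠ x q.1 ω + U q.1 q.2 ω := by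
    rw [ae_all_iff]
    intro p
    rw [ae_all_iff]
    intro q
    by_cases hpq : p = q
    · exact Filter.Eventually.of_forall fun ω h => absurd hpq h
    -- A coincidence means x q - x p = U p - U q. The right side is independent of the parents and
    -- has no atoms, which also covers siblings, where the left side is 0.
    have hU0 : ∀ d, P {ω | U p.1 p.2 ω = d} = 0 := by
      intro d
      have h1 := (hV.law_U p.1 p.2).absolutelyContinuous (Real.volume_singleton (a := d))
      rwa [Measure.map_apply (hV.measurable_U _ _) (measurableSet_singleton d)] at h1
    have hUU : ∀ d, P {ω | U p.1 p.2 ω - U q.1 q.2 ω = d} = 0 := by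
      intro d
      have h1 := measure_eq_eq_zero_of_indepFun ((hV.measurable_U q.1 q.2).add_const d)
        (hV.measurable_U p.1 p.2)
        ((hV.indep_U.indepFun (Ne.symm hpq)).comp (measurable_id.add_const d) measurable_id) hU0
      have h2 : {ω | U p.1 p.2 ω - U q.1 q.2 ω = d} = {ω | U q.1 q.2 ω + d = U p.1 p.2 ω} := by
        ext ω
        simp only [mem_ofPred_eq]
        constructor <;> intro h <;> linarith
      rw [h2]
      exact h1
    have hind : IndepFun (fun ω => x q.1 ω - x p.1 ω)
        (fun ω => U p.1 p.2 ω - U q.1 q.2 ω) P :=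
      hV.indep_parents.comp (φ := fun y : ℕ → ℝ => y q.1 - y p.1)
        (ψ := fun v : (ℕ → ℕ) × (ℕ → ℕ → ℝ) => v.2 p.1 p.2 - v.2 q.1 q.2)
        (by fun_prop) (by fun_prop)
    have h1 := measure_eq_eq_zero_of_indepFun
      ((hV.parents.measurable q.1).sub (hV.parents.measurable p.1))
      ((hV.measurable_U p.1 p.2).sub (hV.measurable_U q.1 q.2)) hind hUU
    have h2 : ∀ᵐ ω ∂P, x q.1 ω - x p.1 ω ≠ U p.1 p.2 ω - U q.1 q.2 ω := by
      rw [ae_iff]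
      simpa using h1
    filter_upwards [h2] with ω hω _ h
    exact hω (by linarith)
  filter_upwards [h] with ω hω p q hpq
  by_contra hne
  exact hω p q hne hpq

/-- Almost surely, the number of points of the cluster process in a ball is the number of daughters
counted with multiplicity, for all balls at the same time. -/
theorem ae_encard_inter_closedBall (hV : IsMaternCluster P x K U lamP m a) :
    ∀ᵐ ω ∂P, ∀ c r, (clusterProcess x K U ω ∩ Metric.closedBall c r).encard =
      ballCount x K U c r ω := by
  filter_upwards [hV.ae_injective] with ω hω c r
  rw [ballCount, daughterCount, ← (hω.injOn).encard_image]
  congr 1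
  ext y
  simp only [clusterProcess, mem_inter_iff, mem_iUnion, mem_ofPred_eq, mem_image, Prod.exists]
  constructor
  · rintro ⟨⟨i, j, hj, rfl⟩, hy⟩
    exact ⟨i, j, ⟨hj, hy⟩, rfl⟩
  · rintro ⟨i, j, ⟨hj, hy⟩, rfl⟩
    exact ⟨⟨i, j, hj, rfl⟩, hy⟩

end IsMaternCluster

end

end Platoon

namespace Platoon

noncomputable section

/-! ### The load of the typical cell -/

theorem fL_nonneg {lam t : ℝ} (ht : 0 ≤ t) : 0 ≤ fL lam t := by
  unfold fL
  positivity

theorem lintegral_fL {lam : ℝ} (hlam : 0 < lam) :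
    ∫⁻ t in Ioi 0, ENNReal.ofReal (fL lam t) = 1 := by
  have := isProbabilityMeasure_expMeasure hlam
  have h := lintegral_half_add_expMeasure hlam (F := fun _ => 1) measurable_const
  simpa using h.symm

theorem measurable_fL (lam : ℝ) : Measurable (fL lam) := by
  unfold fL
  fun_prop

theorem integrableOn_fL {lam : ℝ} (hlam : 0 < lam) : IntegrableOn (fL lam) (Ioi 0) := by
  refine ⟨(measurable_fL lam).aestronglyMeasurable, ?_⟩
  rw [hasFiniteIntegral_iff_ofReal]
  · rw [lintegral_fL hlam]
    exact ENNReal.one_lt_top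
  · filter_upwards [ae_restrict_mem measurableSet_Ioi] with t ht using fL_nonneg (le_of_lt ht)

theorem integrableOn_mul_fL {lam : ℝ} (hlam : 0 < lam) {h : ℝ → ℝ} (hh : Measurable h)
    (h1 : ∀ t, |h t| ≤ 1) : IntegrableOn (fun t => h t * fL lam t) (Ioi 0) :=
  (integrableOn_fL hlam).bdd_mul (c := 1) hh.aestronglyMeasurable
    (Filter.Eventually.of_forall h1)

section Load

variable {Ω : Type*} [MeasurableSpace Ω] {P : Measure Ω} [IsProbabilityMeasure P]
  {lamR lamP m a : ℝ} {z : ℕ → Ω → ℝ} {x : ℕ → Ω → ℝ} {K : ℕ → Ω → ℕ} {U : ℕ → ℕ → Ω → ℝ}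

open IsMaternCluster

theorem measurable_measure_ballCount (hV : IsMaternCluster P x K U lamP m a) (k : ℕ) :
    Measurable fun t : ℝ => P {ω | ballCount x K U 0 (t / 2) ω = k} := by
  have hS : MeasurableSet {p : ℝ × Ω | ballCount x K U 0 (p.1 / 2) p.2 = k} := by
    have h := hV.measurable_ballCount.comp (f := fun p : ℝ × Ω => ((0, p.1 / 2), p.2)) (by fun_prop)
    exact h (measurableSet_singleton (k : ℕ∞))
  exact measurable_measure_prodMk_left hS

/-- Stationarity is read off from the explicit law, which does not involve the center. -/
theorem measure_ballCount_congr (hV : IsMaternCluster P x K U lamP m a) (hlamP : 0 ≤ lamP)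
    (ha : 0 < a) (hm : 0 ≤ m) {r : ℝ} (hr : 0 < r) (c c' : ℝ) (k : ℕ) :
    P {ω | ballCount x K U c r ω = k} = P {ω | ballCount x K U c' r ω = k} := by
  rw [← ENNReal.toReal_eq_toReal_iff' (measure_ne_top _ _) (measure_ne_top _ _),
    hV.measure_ballCount_eq hlamP ha hm hr, hV.measure_ballCount_eq hlamP ha hm hr]

/-- Given its cell, the load of a point is distributed as the number of vehicles in a ball with
the length of the cell. -/
theorem measure_inter_load (hz : IsPoissonProcess P z lamR) (hlamR : 0 < lamR)
    (hV : IsMaternCluster P x K U lamP m a) (hlamP : 0 ≤ lamP) (ha : 0 < a) (hm : 0 ≤ m)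
    (hind : IndepFun (fun ω i => z i ω)
      (fun ω => ((fun i => x i ω), (fun i => K i ω), (fun i j => U i j ω))) P)
    {B : Set ℝ} (hB : MeasurableSet B) (hB1 : volume B ≠ ∞) (i k : ℕ) :
    P ({ω | z i ω ∈ B} ∩ {ω | load z (clusterProcess x K U) i ω = k}) =
      ∫⁻ ω in {ω | z i ω ∈ B}, P {ω' | ballCount x K U 0
        (((gaps (fun j => z j ω) i).1 + (gaps (fun j => z j ω) i).2) / 2 / 2) ω' = k} ∂P := by
  have hzm : Measurable fun ω => (fun j => z j ω) := measurable_pi_iff.2 hz.measurable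
  have hVm : Measurable fun ω => ((fun i => x i ω), (fun i => K i ω), (fun i j => U i j ω)) :=
    hV.measurable_x_seq.prodMk (hV.measurable_K_seq.prodMk hV.measurable_U_seq)
  have hBi : MeasurableSet {ω | z i ω ∈ B} := hz.measurable i hB
  set ctr : (ℕ → ℝ) → ℝ := fun y => y i + ((gaps y i).1 - (gaps y i).2) / 4 with hctr
  set rad : (ℕ → ℝ) → ℝ := fun y => ((gaps y i).1 + (gaps y i).2) / 2 / 2 with hrad
  have hg := measurable_gaps i
  have hctrm : Measurable ctr := (measurable_pi_apply i).add ((hg.fst.sub hg.snd).div_const 4)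
  have hradm : Measurable rad := ((hg.fst.add hg.snd).div_const 2).div_const 2
  -- For good gaps the cell is the ball with center `ctr` and radius `rad`, both functions of the
  -- RSUs alone, so the load event becomes a measurable condition on two independent elements.
  set S : Set ((ℕ → ℝ) × (ℕ → ℝ) × (ℕ → ℕ) × (ℕ → ℕ → ℝ)) :=
    {p | p.1 i ∈ B ∧ daughterCount (ctr p.1) (rad p.1) p.2.1 p.2.2.1 p.2.2.2 = k} with hSdef
  have hS : MeasurableSet S := by
    refine MeasurableSet.inter (((measurable_pi_apply i).comp measurable_fst) hB) ?_
    exact measurable_daughterCount.comp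
      (f := fun p : (ℕ → ℝ) × (ℕ → ℝ) × (ℕ → ℕ) × (ℕ → ℕ → ℝ) => ((ctr p.1, rad p.1), p.2))
      (((hctrm.comp measurable_fst).prodMk (hradm.comp measurable_fst)).prodMk measurable_snd)
      (measurableSet_singleton (k : ℕ∞))
  have hgood := hz.ae_goodGaps hlamR hB hB1 i
  have h1 : P ({ω | z i ω ∈ B} ∩ {ω | load z (clusterProcess x K U) i ω = k}) =
      P {ω | ((fun j => z j ω), ((fun i => x i ω), (fun i => K i ω), (fun i j => U i j ω))) ∈ S} := by
    refine measure_congr ?_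
    rw [ae_restrict_iff' hBi] at hgood
    filter_upwards [hgood, hV.ae_encard_inter_closedBall] with ω hω hω'
    refine propext (and_congr_right fun hi => ?_)
    change load z (clusterProcess x K U) i ω = k ↔ ballCount x K U _ _ ω = k
    rw [load, (hω hi).cell_eq_closedBall, hω']
  rw [h1, measure_of_indepFun hzm hVm hind hS, ← lintegral_indicator hBi]
  refine lintegral_congr_ae ?_
  rw [ae_restrict_iff' hBi] at hgood
  filter_upwards [hgood] with ω hω
  by_cases hi : z i ω ∈ B
  · rw [indicator_of_mem (by exact hi)]
    have hr : 0 < rad fun j => z j ω := by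
      have := (hω hi).2.2
      simp only [hrad]
      linarith
    rw [← measure_ballCount_congr hV hlamP ha hm hr (ctr fun j => z j ω) 0 k]
    congr 1
    ext ω'
    exact and_iff_right hi
  · rw [indicator_of_notMem (by exact hi)]
    have : {ω' | ((fun j => z j ω), ((fun i => x i ω'), (fun i => K i ω'),
        (fun i j => U i j ω'))) ∈ S} = ∅ := by
      ext ω'
      simp [hSdef, hi]
    rw [this, measure_empty]

theorem typicalProb_load (hz : IsPoissonProcess P z lamR) (hlamR : 0 < lamR)
    (hV : IsMaternCluster P x K U lamP m a) (hlamP : 0 ≤ lamP) (ha : 0 < a) (hm : 0 ≤ m)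
    (hind : IndepFun (fun ω i => z i ω)
      (fun ω => ((fun i => x i ω), (fun i => K i ω), (fun i j => U i j ω))) P)
    {B : Set ℝ} (hB : MeasurableSet B) (hB0 : volume B ≠ 0) (hB1 : volume B ≠ ∞) (k : ℕ) :
    typicalProb P z lamR B (fun i => {ω | load z (clusterProcess x K U) i ω = k}) =
      ENNReal.ofReal (∫ t in Ioi (0 : ℝ),
        (P {ω | ballCount x K U 0 (t / 2) ω = k}).toReal * fL lamR t) := by
  have hc0 : ENNReal.ofReal lamR * volume B ≠ 0 := mul_ne_zero (by simpa using hlamR) hB0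
  have hc1 : ENNReal.ofReal lamR * volume B ≠ ∞ := ENNReal.mul_ne_top ENNReal.ofReal_ne_top hB1
  have hm1 := measurable_measure_ballCount hV k
  rw [typicalProb]
  simp_rw [measure_inter_load hz hlamR hV hlamP ha hm hind hB hB1]
  rw [hz.tsum_lintegral_half_add_gaps hlamR hB hB1 hm1, mul_comm, mul_div_assoc,
    ENNReal.div_self hc0 hc1, mul_one, ofReal_integral_eq_lintegral_ofReal]
  · refine lintegral_congr fun t => ?_
    rw [ENNReal.ofReal_mul ENNReal.toReal_nonneg, ENNReal.ofReal_toReal (measure_ne_top _ _)]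
  · refine integrableOn_mul_fL hlamR hm1.ennreal_toReal fun t => ?_
    rw [abs_of_nonneg ENNReal.toReal_nonneg]
    exact measureReal_le_one
  · filter_upwards [ae_restrict_mem measurableSet_Ioi] with t ht
    exact mul_nonneg ENNReal.toReal_nonneg (fL_nonneg (le_of_lt ht))

theorem g_one (lamP m a r : ℝ) : g lamP m a 1 r = 0 := by simp [g]

/-- Both the measurability in t and the bound by 1 come from writing exp(g) as the expectation of s
^ count. -/
theorem integrableOn_exp_g_mul_fL (hlamR : 0 < lamR)
    (hV : IsMaternCluster P x K U lamP m a) (hlamP : 0 ≤ lamP) (ha : 0 < a) (hm : 0 ≤ m)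
    {s : ℝ} (hs : s ∈ Icc (-1 : ℝ) 1) :
    IntegrableOn (fun t => Real.exp (g lamP m a s (t / 2)) * fL lamR t) (Ioi 0) := by
  have hs' : |s| ≤ 1 := abs_le.2 hs
  have h1 : ∀ n : ℕ, ‖s ^ n‖ ≤ 1 := fun n => by
    rw [Real.norm_eq_abs, abs_pow]
    exact pow_le_one₀ (abs_nonneg s) hs'
  have hmeas : Measurable fun t : ℝ => ∫ ω, s ^ (ballCount x K U 0 (t / 2) ω).toNat ∂P := by
    have h2 : Measurable fun p : ℝ × Ω => s ^ (ballCount x K U 0 (p.1 / 2) p.2).toNat :=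
      (Measurable.of_discrete (f := fun n : ℕ∞ => s ^ n.toNat)).comp
        (hV.measurable_ballCount.comp (f := fun p : ℝ × Ω => ((0, p.1 / 2), p.2)) (by fun_prop))
    exact h2.stronglyMeasurable.integral_prod_right'.measurable
  refine (integrableOn_mul_fL hlamR hmeas fun t => ?_).congr_fun (fun t ht => ?_) measurableSet_Ioi
  · have := norm_integral_le_of_norm_le_const (μ := P)
      (f := fun ω => s ^ (ballCount x K U 0 (t / 2) ω).toNat)
      (Filter.Eventually.of_forall fun ω => h1 _)
    simpa using this
  · simp only
    rw [hV.integral_pow_ballCount hlamP ha hm (half_pos ht) 0 hs]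

/-- The terms are dominated by those at s = 1, whose sum is `fL` because g(1, r) = 0; this justifies
summing under the integral. -/
theorem hasSum_integral_ballCount_mul_fL (hlamR : 0 < lamR)
    (hV : IsMaternCluster P x K U lamP m a) (hlamP : 0 ≤ lamP) (ha : 0 < a) (hm : 0 ≤ m)
    {s : ℝ} (hs : s ∈ Icc (-1 : ℝ) 1) :
    HasSum (fun k : ℕ => (∫ t in Ioi (0 : ℝ),
        (P {ω | ballCount x K U 0 (t / 2) ω = k}).toReal * fL lamR t) * s ^ k)
      (∫ t in Ioi (0 : ℝ), Real.exp (g lamP m a s (t / 2)) * fL lamR t) := by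
  have hs' : |s| ≤ 1 := abs_le.2 hs
  have hsum : ∀ s ∈ Icc (-1 : ℝ) 1, ∀ t ∈ Ioi (0 : ℝ),
      HasSum (fun k : ℕ => (P {ω | ballCount x K U 0 (t / 2) ω = k}).toReal * fL lamR t * s ^ k)
        (Real.exp (g lamP m a s (t / 2)) * fL lamR t) := fun s hs t ht => by
    simpa only [mul_right_comm] using
      (hV.hasSum_ballCount hlamP ha hm (half_pos ht) 0 hs).mul_right (fL lamR t)
  have hone : ∀ t ∈ Ioi (0 : ℝ), HasSum
      (fun k : ℕ => (P {ω | ballCount x K U 0 (t / 2) ω = k}).toReal * fL lamR t) (fL lamR t) := by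
    intro t ht
    simpa [g_one] using hsum 1 (by simp) t ht
  simp_rw [← integral_mul_const]
  refine hasSum_integral_of_dominated_convergence
    (fun k t => (P {ω | ballCount x K U 0 (t / 2) ω = k}).toReal * fL lamR t) ?_ ?_ ?_ ?_ ?_
  · exact fun k => (((measurable_measure_ballCount hV k).ennreal_toReal.mul
      (measurable_fL lamR)).mul_const _).aestronglyMeasurable
  · intro k
    filter_upwards [ae_restrict_mem measurableSet_Ioi] with t ht
    have h0 : 0 ≤ (P {ω | ballCount x K U 0 (t / 2) ω = k}).toReal * fL lamR t :=
      mul_nonneg ENNReal.toReal_nonneg (fL_nonneg (le_of_lt ht))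
    rw [norm_mul, Real.norm_of_nonneg h0, Real.norm_eq_abs, abs_pow]
    exact mul_le_of_le_one_right h0 (pow_le_one₀ (abs_nonneg s) hs')
  · filter_upwards [ae_restrict_mem measurableSet_Ioi] with t ht using (hone t ht).summable
  · exact (integrableOn_fL hlamR).congr_fun (fun t ht => (hone t ht).tsum_eq.symm) measurableSet_Ioi
  · filter_upwards [ae_restrict_mem measurableSet_Ioi] with t ht using hsum s hs t ht

end Load

end

end Platoon

/-! ### The ball count, the typical cell length and the typical load -/

theorem theorem1 {Ω : Type*} [MeasurableSpace Ω] (P : Measure Ω) [IsProbabilityMeasure P]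
    (lamR lamP m a : ℝ) (hlamR : 0 < lamR) (hlamP : 0 < lamP) (hm : 0 < m) (ha : 0 < a)
    -- the RSUs
    (z : ℕ → Ω → ℝ) (hz : Platoon.IsPoissonProcess P z lamR)
    -- the parents, the numbers of daughters and the displacements of the vehicles
    (x : ℕ → Ω → ℝ) (K : ℕ → Ω → ℕ) (U : ℕ → ℕ → Ω → ℝ)
    (hV : Platoon.IsMaternCluster P x K U lamP m a)
    -- the RSUs are independent of the vehicles
    (hind : IndepFun (fun ω i => z i ω)
      (fun ω => ((fun i => x i ω), (fun i => K i ω), (fun i j => U i j ω))) P)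
    -- the window over which the typical RSU is taken
    (B : Set ℝ) (hB : MeasurableSet B) (hB0 : volume B ≠ 0) (hB1 : volume B ≠ ∞) :
    -- `exp (g s r)` is the PGF of the number of vehicles in a ball of radius `r`
    (∀ c r : ℝ, 0 < r → ∀ s ∈ Icc (-1 : ℝ) 1,
      HasSum (fun k : ℕ => (P {ω | (Platoon.clusterProcess x K U ω ∩
          Metric.closedBall c r).encard = k}).toReal * s ^ k)
        (Real.exp (Platoon.g lamP m a s r))) ∧
    -- `fL` is the density of the length of the typical cell
    (∀ A : Set ℝ, MeasurableSet A →
      Platoon.typicalProb P z lamR B (fun i => {ω | volume.real (Platoon.cell z i ω) ∈ A}) =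
        ∫⁻ t in A ∩ Ioi 0, ENNReal.ofReal (Platoon.fL lamR t)) ∧
    -- the PGF of the load on the typical RSU
    (∀ s ∈ Icc (-1 : ℝ) 1,
      IntegrableOn (fun t => Real.exp (Platoon.g lamP m a s (t / 2)) * Platoon.fL lamR t)
        (Ioi 0) ∧
      HasSum (fun k : ℕ => (Platoon.typicalProb P z lamR B
          (fun i => {ω | Platoon.load z (Platoon.clusterProcess x K U) i ω = k})).toReal * s ^ k)
        (∫ t in Ioi (0 : ℝ),
          Real.exp (Platoon.g lamP m a s (t / 2)) * Platoon.fL lamR t)) ∧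
    -- the PMF of the load on the typical RSU
    (∀ k : ℕ,
      IntegrableOn (fun t => Platoon.faaDiBruno lamP m a k (t / 2) * Platoon.fL lamR t)
        (Ioi 0) ∧
      Platoon.typicalProb P z lamR B
          (fun i => {ω | Platoon.load z (Platoon.clusterProcess x K U) i ω = k}) =
        ENNReal.ofReal (∫ t in Ioi (0 : ℝ),
          Platoon.faaDiBruno lamP m a k (t / 2) * Platoon.fL lamR t)) := by
  -- The law of the ball count is known for positive radii only, so the two integrands are compared
  -- on the open half-line.
  have hball : ∀ t ∈ Ioi (0 : ℝ), ∀ k : ℕ,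
      (P {ω | Platoon.IsMaternCluster.ballCount x K U 0 (t / 2) ω = k}).toReal * Platoon.fL lamR t =
        Platoon.faaDiBruno lamP m a k (t / 2) * Platoon.fL lamR t := fun t ht k => by
    rw [hV.measure_ballCount_eq hlamP.le ha hm.le (half_pos ht)]
  refine ⟨fun c r hr s hs => ?_, fun A hA => hz.typicalProb_volume_cell hlamR hB hB0 hB1 hA,
    fun s hs => ⟨Platoon.integrableOn_exp_g_mul_fL hlamR hV hlamP.le ha hm.le hs, ?_⟩,
    fun k => ⟨?_, ?_⟩⟩
  · have heq : ∀ k : ℕ, P {ω | (Platoon.clusterProcess x K U ω ∩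
        Metric.closedBall c r).encard = k} =
        P {ω | Platoon.IsMaternCluster.ballCount x K U c r ω = k} := fun k => by
      refine measure_congr ?_
      filter_upwards [hV.ae_encard_inter_closedBall] with ω hω
      exact congrArg (· = (k : ℕ∞)) (hω c r)
    simp_rw [heq]
    exact hV.hasSum_ballCount hlamP.le ha hm.le hr c hs
  · convert Platoon.hasSum_integral_ballCount_mul_fL hlamR hV hlamP.le ha hm.le hs using 3 with k
    rw [Platoon.typicalProb_load hz hlamR hV hlamP.le ha hm.le hind hB hB0 hB1,
      ENNReal.toReal_ofReal]
    exact setIntegral_nonneg measurableSet_Ioi fun t ht =>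
      mul_nonneg ENNReal.toReal_nonneg (Platoon.fL_nonneg (le_of_lt ht))
  · refine (Platoon.integrableOn_mul_fL hlamR
      (Platoon.measurable_measure_ballCount hV k).ennreal_toReal fun t => ?_).congr_fun
      (fun t ht => hball t ht k) measurableSet_Ioi
    rw [abs_of_nonneg ENNReal.toReal_nonneg]
    exact measureReal_le_one
  · rw [Platoon.typicalProb_load hz hlamR hV hlamP.le ha hm.le hind hB hB0 hB1]
    congr 1
    exact setIntegral_congr_fun measurableSet_Ioi fun t ht => hball t ht k
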